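/- For each integer $k\ge 1$ define \[ f(k):=\sum_{1\le m_1,m_2,m_3\le k}\frac{1}{(m_1+m_2)(m_2+m_3)(m_1+m_3)}-\int_{[1,k+1]^3}\frac{dx\,dy\,dz}{(x+y)(y+z)(z+x)}, \] where the sum runs over all triples of integers $m_1,m_2,m_3$ in $\{1,\dots,k\}$. Then \[ \lim_{k\to+\infty}f(k)=\frac{3}{2}\,\zeta(2)\,\gamma+\frac{1}{8}\,\zeta(3), \] where $\zeta$ is the Riemann zeta function and $\gamma=\lim_{k\to+\infty}\left(\sum_{n=1}^{k}\frac1n-\log k\right)$ is Euler's constant. -/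

import Mathlib

/-- The difference `f(k)` between the symmetric triple sum over `1 ≤ m₁, m₂, m₃ ≤ k` and the
integral, with respect to Lebesgue measure on `ℝ × ℝ × ℝ`, over the cube `[1, k + 1]³`. A point
of the cube is a triple `p = (x, y, z)` with `x = p.1`, `y = p.2.1`, `z = p.2.2`. -/
noncomputable def symmetricDifference (k : ℕ) : ℝ :=
  (∑ m₁ ∈ Finset.Icc 1 k, ∑ m₂ ∈ Finset.Icc 1 k, ∑ m₃ ∈ Finset.Icc 1 k,
      1 / (((m₁ : ℝ) + (m₂ : ℝ)) * ((m₂ : ℝ) + (m₃ : ℝ)) * ((m₁ : ℝ) + (m₃ : ℝ))))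
    - ∫ p : ℝ × ℝ × ℝ in
        Set.Icc (1 : ℝ) ((k : ℝ) + 1) ×ˢ
          (Set.Icc (1 : ℝ) ((k : ℝ) + 1) ×ˢ Set.Icc (1 : ℝ) ((k : ℝ) + 1)),
        1 / ((p.1 + p.2.1) * (p.2.1 + p.2.2) * (p.2.2 + p.1))

open Filter Topology MeasureTheory Set

/-! The sum and the integral each grow like (3/2) ζ(2) log k; both are reduced to explicit
one-variable integrals, and the constants are compared.

Sum: partial fractions in the middle variable, then antisymmetry in the outer two, give the exact
identity `symmetric_sum_eq`, S = -R + (3/2) H_k ∑ 1/a² - (5/4) T. The middle term equals (3/2) ζ(2)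
(log k + γ) + o(1). The Tornheim sum T tends to ∫ log²(1-u)/u = 2ζ(3). R is a Riemann sum: since H_n
= log n + γ + o(1), dominated convergence gives ∫ log((1+t)/t) log((1+t)/(1-t))/t = (21/8) ζ(3).

Integral: by symmetry it is six times the part over x < y < z. Integrating out y, putting z =
x(1+v)/(1-v) and integrating dx/x leaves, with N = k + 1, the integral over (0,1) of -3 log(1-v²)/v
· max(log N - log((1+v)/(1-v)), 0) (`integral_cube_eq`), which is (3/2) ζ(2) log N - (21/4) ζ(3) +
o(1).

All the constants come from four integrals of products of logarithms, each a multiple of ζ(3). In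
the difference the logarithms cancel, and -21/8 - 5/2 + 21/4 = 1/8. -/

theorem HasSum.of_eq {f g : ℕ → ℝ} {a b : ℝ} (h : HasSum f a) (hfg : ∀ n, g n = f n)
    (hab : b = a) : HasSum g b := by
  rwa [hab, funext hfg]

/-! ### Calculus of integrals over the unit interval. -/

/-- `f` is integrable on `(0, 1)` with integral `v`. -/
def HasUnitIntegral (f : ℝ → ℝ) (v : ℝ) : Prop :=
  IntegrableOn f (Ioo 0 1) ∧ ∫ t in Ioo (0 : ℝ) 1, f t = v

namespace HasUnitIntegral

theorem add {f g : ℝ → ℝ} {a b : ℝ} (hf : HasUnitIntegral f a) (hg : HasUnitIntegral g b) :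
    HasUnitIntegral (fun t => f t + g t) (a + b) :=
  ⟨hf.1.add hg.1, by rw [integral_add hf.1 hg.1, hf.2, hg.2]⟩

theorem const_mul {f : ℝ → ℝ} {a : ℝ} (hf : HasUnitIntegral f a) (c : ℝ) :
    HasUnitIntegral (fun t => c * f t) (c * a) :=
  ⟨hf.1.const_mul c, by rw [integral_const_mul, hf.2]⟩

theorem congr {f g : ℝ → ℝ} {a b : ℝ} (hf : HasUnitIntegral f a)
    (h : ∀ t ∈ Ioo (0 : ℝ) 1, g t = f t) (hab : b = a) : HasUnitIntegral g b :=
  ⟨hf.1.congr_fun (fun t ht => (h t ht).symm) measurableSet_Ioo,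
    by rw [setIntegral_congr_fun measurableSet_Ioo h, hf.2, hab]⟩

/-- Termwise integration of a series of nonnegative functions. -/
theorem of_hasSum {f : ℕ → ℝ → ℝ} {F : ℝ → ℝ} {c : ℕ → ℝ} {v : ℝ}
    (hf : ∀ n, HasUnitIntegral (f n) (c n)) (hnn : ∀ n, ∀ t ∈ Ioo (0 : ℝ) 1, 0 ≤ f n t)
    (hc : HasSum c v) (hv : v ≠ 0) (hF : ∀ t ∈ Ioo (0 : ℝ) 1, HasSum (fun n => f n t) (F t)) :
    HasUnitIntegral F v := by
  have h1 : HasSum (fun n => ∫ t in Ioo (0 : ℝ) 1, f n t)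
      (∫ t in Ioo (0 : ℝ) 1, ∑' n, f n t) := by
    refine hasSum_integral_of_summable_integral_norm (fun n => (hf n).1) ?_
    refine hc.summable.congr fun n => ?_
    rw [← (hf n).2]
    refine setIntegral_congr_fun measurableSet_Ioo fun t ht => ?_
    exact (Real.norm_of_nonneg (hnn n t ht)).symm
  have h2 : ∫ t in Ioo (0 : ℝ) 1, ∑' n, f n t = ∫ t in Ioo (0 : ℝ) 1, F t :=
    setIntegral_congr_fun measurableSet_Ioo fun t ht => (hF t ht).tsum_eq
  have h3 : ∫ t in Ioo (0 : ℝ) 1, F t = v := by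
    rw [← h2]
    refine h1.unique ?_
    convert hc using 2 with n
    exact (hf n).2
  -- A non-integrable function has integral 0 by convention, so a nonzero value already forces
  -- integrability.
  exact ⟨Integrable.of_integral_ne_zero (by rw [h3]; exact hv), h3⟩

/-- Change of variables for a substitution of `(0, 1)` onto itself. -/
theorem comp_of_image {f φ φ' : ℝ → ℝ} {v : ℝ} (hf : HasUnitIntegral f v)
    (hφ : ∀ t ∈ Ioo (0 : ℝ) 1, HasDerivAt φ (φ' t) t) (hinj : InjOn φ (Ioo 0 1))
    (him : φ '' Ioo 0 1 = Ioo 0 1) : HasUnitIntegral (fun t => |φ' t| * f (φ t)) v := by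
  have hd : ∀ t ∈ Ioo (0 : ℝ) 1, HasDerivWithinAt φ (φ' t) (Ioo 0 1) t :=
    fun t ht => (hφ t ht).hasDerivWithinAt
  have h1 := integrableOn_image_iff_integrableOn_abs_deriv_smul measurableSet_Ioo hd hinj f
  have h2 := integral_image_eq_integral_abs_deriv_smul measurableSet_Ioo hd hinj f
  rw [him] at h1 h2
  exact ⟨h1.1 hf.1, by rw [← hf.2, h2]; rfl⟩

/-- The fundamental theorem of calculus for a nonnegative derivative. -/
theorem of_hasDerivAt {f F : ℝ → ℝ} (hc : ContinuousOn F (Icc 0 1))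
    (hd : ∀ t ∈ Ioo (0 : ℝ) 1, HasDerivAt F (f t) t) (hnn : ∀ t ∈ Ioo (0 : ℝ) 1, 0 ≤ f t) :
    HasUnitIntegral f (F 1 - F 0) := by
  have h1 : IntegrableOn f (Ioc 0 1) := intervalIntegral.integrableOn_deriv_of_nonneg hc hd hnn
  refine ⟨h1.mono_set Ioo_subset_Ioc_self, ?_⟩
  rw [← integral_Ioc_eq_integral_Ioo, ← intervalIntegral.integral_of_le zero_le_one]
  exact intervalIntegral.integral_eq_sub_of_hasDerivAt_of_le zero_le_one hc hd
    ((intervalIntegrable_iff_integrableOn_Ioc_of_le zero_le_one).2 h1)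

end HasUnitIntegral

/-! ### Moments of powers of the logarithm. -/

/-- Since log t = 2 log √t, the function is 4 (√t log √t)². Continuity at 0 is what the
antiderivative of log² t · tⁿ needs at its endpoint. -/
theorem continuousOn_mul_log_sq : ContinuousOn (fun t : ℝ => t * Real.log t ^ 2) (Icc 0 1) := by
  have h : Continuous (fun t : ℝ => 4 * (√t * Real.log √t) ^ 2) :=
    continuous_const.mul ((Real.continuous_mul_log.comp Real.continuous_sqrt).pow 2)
  refine h.continuousOn.congr fun t ht => ?_
  simp only
  rw [Real.log_sqrt ht.1, mul_pow, Real.sq_sqrt ht.1]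
  ring

theorem hasUnitIntegral_pow (n : ℕ) : HasUnitIntegral (fun t => t ^ n) (1 / ((n : ℝ) + 1)) := by
  have hn : (n : ℝ) + 1 ≠ 0 := by positivity
  have h := HasUnitIntegral.of_hasDerivAt (f := fun t => t ^ n)
    (F := fun t : ℝ => t ^ (n + 1) / ((n : ℝ) + 1)) (by fun_prop)
    (fun t ht => by
      have := (hasDerivAt_pow (n + 1) t).div_const ((n : ℝ) + 1)
      refine this.congr_deriv ?_
      push_cast
      field_simp)
    (fun t ht => pow_nonneg ht.1.le n)
  simpa using h

theorem hasUnitIntegral_neg_log_mul_pow (n : ℕ) :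
    HasUnitIntegral (fun t => -Real.log t * t ^ n) (1 / ((n : ℝ) + 1) ^ 2) := by
  have hn : (n : ℝ) + 1 ≠ 0 := by positivity
  have h := HasUnitIntegral.of_hasDerivAt (f := fun t => -Real.log t * t ^ n)
    (F := fun t : ℝ => -(t ^ n * (t * Real.log t)) / ((n : ℝ) + 1)
      + t ^ (n + 1) / ((n : ℝ) + 1) ^ 2)
    (by
      have := Real.continuous_mul_log
      fun_prop)
    (fun t ht => by
      have h0 : t ≠ 0 := ht.1.ne'
      have h1 : HasDerivAt (fun t : ℝ => -(t ^ (n + 1) * Real.log t) / ((n : ℝ) + 1)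
        + t ^ (n + 1) / ((n : ℝ) + 1) ^ 2) (-Real.log t * t ^ n) t := by
        have := ((((hasDerivAt_pow (n + 1) t).mul (Real.hasDerivAt_log h0)).neg).div_const
          ((n : ℝ) + 1)).add ((hasDerivAt_pow (n + 1) t).div_const (((n : ℝ) + 1) ^ 2))
        refine this.congr_deriv ?_
        push_cast
        field_simp
        ring
      convert h1 using 1
      funext t
      ring)
    (fun t ht => mul_nonneg (by
      have := Real.log_nonpos ht.1.le ht.2.le
      linarith) (pow_nonneg ht.1.le n))
  simpa using h

theorem hasUnitIntegral_log_sq_mul_pow (n : ℕ) :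
    HasUnitIntegral (fun t => Real.log t ^ 2 * t ^ n) (2 / ((n : ℝ) + 1) ^ 3) := by
  have hn : (n : ℝ) + 1 ≠ 0 := by positivity
  have h := HasUnitIntegral.of_hasDerivAt (f := fun t => Real.log t ^ 2 * t ^ n)
    (F := fun t : ℝ => t ^ n * (t * Real.log t ^ 2) / ((n : ℝ) + 1)
      - 2 * (t ^ n * (t * Real.log t)) / ((n : ℝ) + 1) ^ 2
      + 2 * t ^ (n + 1) / ((n : ℝ) + 1) ^ 3)
    (by
      have := Real.continuous_mul_log
      have := continuousOn_mul_log_sq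
      fun_prop)
    (fun t ht => by
      have h0 : t ≠ 0 := ht.1.ne'
      have h1 : HasDerivAt (fun t : ℝ => t ^ (n + 1) * Real.log t ^ 2 / ((n : ℝ) + 1)
          - 2 * (t ^ (n + 1) * Real.log t) / ((n : ℝ) + 1) ^ 2
          + 2 * t ^ (n + 1) / ((n : ℝ) + 1) ^ 3) (Real.log t ^ 2 * t ^ n) t := by
        have hp := hasDerivAt_pow (n + 1) t
        have hl := Real.hasDerivAt_log h0
        have := (((hp.mul (hl.pow 2)).div_const ((n : ℝ) + 1)).sub
          (((hp.mul hl).const_mul 2).div_const (((n : ℝ) + 1) ^ 2))).add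
          ((hp.const_mul 2).div_const (((n : ℝ) + 1) ^ 3))
        refine this.congr_deriv ?_
        push_cast
        simp only [Pi.pow_apply]
        field_simp
        ring
      convert h1 using 1
      funext t
      ring)
    (fun t ht => mul_nonneg (sq_nonneg _) (pow_nonneg ht.1.le n))
  simpa using h

/-! ### Zeta values as real series. -/

/-- The real number `ζ(2)`. -/
noncomputable def zetaTwo : ℝ := ∑' n : ℕ, 1 / ((n : ℝ) + 1) ^ 2

/-- The real number `ζ(3)`. -/
noncomputable def zetaThree : ℝ := ∑' n : ℕ, 1 / ((n : ℝ) + 1) ^ 3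

theorem summable_one_div_nat_add_one_pow {p : ℕ} (hp : 1 < p) :
    Summable fun n : ℕ => 1 / ((n : ℝ) + 1) ^ p := by
  have := (summable_nat_add_iff 1).2 (Real.summable_one_div_nat_pow.2 hp)
  simpa using this

theorem hasSum_zetaTwo : HasSum (fun n : ℕ => 1 / ((n : ℝ) + 1) ^ 2) zetaTwo :=
  (summable_one_div_nat_add_one_pow (by norm_num)).hasSum

theorem hasSum_zetaThree : HasSum (fun n : ℕ => 1 / ((n : ℝ) + 1) ^ 3) zetaThree :=
  (summable_one_div_nat_add_one_pow (by norm_num)).hasSum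

theorem zetaTwo_pos : 0 < zetaTwo :=
  hasSum_zetaTwo.summable.tsum_pos (fun n => by positivity) 0 (by norm_num)

theorem zetaThree_pos : 0 < zetaThree :=
  hasSum_zetaThree.summable.tsum_pos (fun n => by positivity) 0 (by norm_num)

theorem riemannZeta_two_eq : riemannZeta 2 = (zetaTwo : ℂ) := by
  have h := zeta_nat_eq_tsum_of_gt_one (k := 2) (by norm_num)
  have h2 : (∑' n : ℕ, 1 / (n : ℝ) ^ 2) = zetaTwo := by
    rw [(Real.summable_one_div_nat_pow.2 (by norm_num : 1 < 2)).tsum_eq_zero_add]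
    simp [zetaTwo]
  rw [← h2]
  push_cast
  simpa using h

theorem riemannZeta_three_eq : riemannZeta 3 = (zetaThree : ℂ) := by
  have h := zeta_nat_eq_tsum_of_gt_one (k := 3) (by norm_num)
  have h2 : (∑' n : ℕ, 1 / (n : ℝ) ^ 3) = zetaThree := by
    rw [(Real.summable_one_div_nat_pow.2 (by norm_num : 1 < 3)).tsum_eq_zero_add]
    simp [zetaThree]
  rw [← h2]
  push_cast
  simpa using h

theorem hasSum_odd_zetaThree :
    HasSum (fun n : ℕ => 1 / (2 * (n : ℝ) + 1) ^ 3) (7 / 8 * zetaThree) := by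
  have h1 : Summable (fun n : ℕ => 1 / (2 * (n : ℝ) + 1) ^ 3) := by
    have := hasSum_zetaThree.summable.comp_injective
      (mul_right_injective₀ (two_ne_zero : (2 : ℕ) ≠ 0))
    refine this.congr fun n => ?_
    simp
  have h2 : HasSum (fun n : ℕ => 1 / (((2 * n + 1 : ℕ) : ℝ) + 1) ^ 3) (1 / 8 * zetaThree) := by
    refine (hasSum_zetaThree.mul_left (1 / 8)).of_eq (fun n => ?_) rfl
    push_cast
    field_simp
    ring
  have h3 := HasSum.even_add_odd (f := fun n : ℕ => 1 / ((n : ℝ) + 1) ^ 3)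
    (by simpa only [Nat.cast_mul, Nat.cast_ofNat] using h1.hasSum) h2
  have h4 := h3.unique hasSum_zetaThree
  have h5 := h1.hasSum
  convert h5 using 1
  linarith

/-! ### The logarithmic integrals. -/

/-- Reflect u ↦ 1 - u and expand 1/(1-t) geometrically. -/
theorem hasUnitIntegral_log_one_sub_sq :
    HasUnitIntegral (fun u => Real.log (1 - u) ^ 2 / u) (2 * zetaThree) := by
  have h1 : HasUnitIntegral (fun t => Real.log t ^ 2 / (1 - t)) (2 * zetaThree) := by
    refine HasUnitIntegral.of_hasSum hasUnitIntegral_log_sq_mul_pow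
      (fun n t ht => mul_nonneg (sq_nonneg _) (pow_nonneg ht.1.le n)) ?_
      (by have := zetaThree_pos; positivity) ?_
    · exact (hasSum_zetaThree.mul_left 2).of_eq (fun n => by ring) rfl
    · intro t ht
      exact (hasSum_geometric_of_lt_one ht.1.le ht.2).mul_left _
  refine (h1.comp_of_image (φ := fun u => 1 - u) (φ' := fun _ => -1)
    (fun t _ => by simpa using (hasDerivAt_id t).const_sub 1) (fun a _ b _ h => by
      simpa using h) (by simp)).congr (fun t _ => by simp) rfl

theorem hasUnitIntegral_log_one_sub_sq_sq :
    HasUnitIntegral (fun u => Real.log (1 - u ^ 2) ^ 2 / u) zetaThree := by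
  have him : (fun u : ℝ => u ^ 2) '' Ioo 0 1 = Ioo 0 1 := by
    ext y
    constructor
    · rintro ⟨x, ⟨h0, h1⟩, rfl⟩
      exact ⟨by positivity, by nlinarith⟩
    · rintro ⟨h0, h1⟩
      exact ⟨√y, ⟨Real.sqrt_pos.2 h0, (Real.sqrt_lt' one_pos).2 (by simpa using h1)⟩,
        Real.sq_sqrt h0.le⟩
  refine ((hasUnitIntegral_log_one_sub_sq.comp_of_image (φ := fun u => u ^ 2)
    (φ' := fun u => 2 * u) (fun t _ => by simpa using hasDerivAt_pow 2 t)
    (fun a ha b hb h => ?_) him).const_mul (1 / 2)).congr (fun t ht => ?_) (by ring)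
  · exact (sq_eq_sq₀ ha.1.le hb.1.le).1 h
  · have := ht.1
    rw [abs_of_pos (by linarith)]
    field_simp

/-- The involution u ↦ (1-u)/(1+u) turns the squared logarithm into log² t and du/u into 2
dt/(1-t²); the geometric series in t² then leaves only odd cubes. -/
theorem hasUnitIntegral_log_div_sq :
    HasUnitIntegral (fun u => (Real.log (1 + u) - Real.log (1 - u)) ^ 2 / u)
      (7 / 2 * zetaThree) := by
  have h1 : HasUnitIntegral (fun t => Real.log t ^ 2 / (1 - t ^ 2)) (7 / 4 * zetaThree) := by
    refine HasUnitIntegral.of_hasSum (fun n => hasUnitIntegral_log_sq_mul_pow (2 * n))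
      (fun n t ht => mul_nonneg (sq_nonneg _) (pow_nonneg ht.1.le _)) ?_
      (by have := zetaThree_pos; positivity) ?_
    · exact (hasSum_odd_zetaThree.mul_left 2).of_eq (fun n => by push_cast; ring) (by ring)
    · intro t ht
      simp_rw [pow_mul]
      exact (hasSum_geometric_of_lt_one (sq_nonneg t)
        (by nlinarith [ht.1, ht.2])).mul_left _
  have hinv : ∀ t ∈ Ioo (0 : ℝ) 1, (1 - t) / (1 + t) ∈ Ioo (0 : ℝ) 1 := fun t ht => by
    have := ht.1
    have := ht.2
    exact ⟨div_pos (by linarith) (by linarith), (div_lt_one (by linarith)).2 (by linarith)⟩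
  have hinv2 : ∀ t ∈ Ioo (0 : ℝ) 1, (1 - (1 - t) / (1 + t)) / (1 + (1 - t) / (1 + t)) = t :=
    fun t ht => by
      have := ht.1
      have h1 : 1 + t ≠ 0 := by positivity
      field_simp
      ring
  refine ((h1.comp_of_image (φ := fun u => (1 - u) / (1 + u)) (φ' := fun u => -2 / (1 + u) ^ 2)
    (fun t ht => ?_) (fun a ha b hb h => ?_) ?_).const_mul 2).congr (fun t ht => ?_) (by ring)
  · have h1 : 1 + t ≠ 0 := by have := ht.1; positivity
    refine (((hasDerivAt_id t).const_sub 1).div ((hasDerivAt_id t).const_add 1) h1).congr_deriv ?_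
    simp only [id]
    ring
  · rw [← hinv2 a ha, ← hinv2 b hb]
    simp only at h
    rw [h]
  · ext y
    constructor
    · rintro ⟨x, hx, rfl⟩
      exact hinv x hx
    · intro hy
      exact ⟨_, hinv y hy, hinv2 y hy⟩
  · have h0 := ht.1
    have h2 := ht.2
    have h3 : 1 - t ≠ 0 := by linarith
    have h4 : 1 + t ≠ 0 := by positivity
    rw [Real.log_div h3 h4, abs_div, abs_of_pos (by positivity : 0 < (1 + t) ^ 2)]
    have h5 : 1 - ((1 - t) / (1 + t)) ^ 2 = 4 * t / (1 + t) ^ 2 := by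
      field_simp
      ring
    rw [h5]
    norm_num
    field_simp
    ring

theorem hasUnitIntegral_log_mul_log_div :
    HasUnitIntegral (fun t => -Real.log t * ((Real.log (1 + t) - Real.log (1 - t)) / t))
      (7 / 4 * zetaThree) := by
  refine HasUnitIntegral.of_hasSum
    (f := fun n t => 2 / (2 * (n : ℝ) + 1) * (-Real.log t * t ^ (2 * n)))
    (fun n => (hasUnitIntegral_neg_log_mul_pow (2 * n)).const_mul _)
    (fun n t ht => ?_) ?_ (by have := zetaThree_pos; positivity) ?_
  · have := Real.log_nonpos ht.1.le ht.2.le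
    have := ht.1
    exact mul_nonneg (by positivity) (mul_nonneg (by linarith) (by positivity))
  · exact (hasSum_odd_zetaThree.mul_left 2).of_eq (fun n => by push_cast; field_simp) (by ring)
  · intro t ht
    have h := (Real.hasSum_log_sub_log_of_abs_lt_one (x := t)
      (by rw [abs_of_pos ht.1]; exact ht.2)).mul_left (-Real.log t / t)
    have := ht.1.ne'
    exact h.of_eq (fun n => by field_simp; ring) (by field_simp)

theorem hasUnitIntegral_neg_log_one_sub_sq :
    HasUnitIntegral (fun v => -Real.log (1 - v ^ 2) / v) (1 / 2 * zetaTwo) := by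
  refine HasUnitIntegral.of_hasSum
    (f := fun n t => 1 / ((n : ℝ) + 1) * t ^ (2 * n + 1))
    (fun n => (hasUnitIntegral_pow (2 * n + 1)).const_mul _)
    (fun n t ht => ?_) ?_ (by have := zetaTwo_pos; positivity) ?_
  · have := ht.1
    positivity
  · refine (hasSum_zetaTwo.mul_left (1 / 2)).of_eq (fun n => ?_) rfl
    push_cast
    field_simp
    ring
  · intro t ht
    have h := (Real.hasSum_pow_div_log_of_abs_lt_one (x := t ^ 2)
      (by rw [abs_of_nonneg (sq_nonneg t)]; nlinarith [ht.1, ht.2])).mul_left (1 / t)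
    have := ht.1.ne'
    exact h.of_eq (fun n => by field_simp; ring) (by field_simp)

/-! ### Exact evaluation of the triple sum. -/

/-- The `n`-th harmonic number as a real number. -/
noncomputable def harmonicSum (n : ℕ) : ℝ := ∑ i ∈ Finset.Icc 1 n, 1 / (i : ℝ)

theorem harmonicSum_zero : harmonicSum 0 = 0 := by simp [harmonicSum]

theorem harmonicSum_succ (n : ℕ) :
    harmonicSum (n + 1) = harmonicSum n + 1 / ((n : ℝ) + 1) := by
  rw [harmonicSum, Finset.sum_Icc_succ_top (by omega)]
  simp [harmonicSum]

theorem harmonicSum_eq_harmonic (n : ℕ) : harmonicSum n = (harmonic n : ℝ) := by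
  rw [harmonic_eq_sum_Icc, harmonicSum]
  push_cast
  simp

theorem sum_one_div_add (a k : ℕ) :
    ∑ b ∈ Finset.Icc 1 k, 1 / ((a : ℝ) + b) = harmonicSum (k + a) - harmonicSum a := by
  induction k with
  | zero => simp
  | succ k ih =>
    rw [Finset.sum_Icc_succ_top (by omega), ih, show k + 1 + a = (k + a) + 1 by ring,
      harmonicSum_succ]
    push_cast
    ring

/-- The term `c = m + 1` contributes `1 / 0 = 0`. -/
theorem sum_one_div_sub (m r : ℕ) :
    ∑ c ∈ Finset.Icc 1 (m + 1 + r), 1 / (((m + 1 : ℕ) : ℝ) - c)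
      = harmonicSum m - harmonicSum r := by
  induction r with
  | zero =>
    rw [add_zero, Finset.sum_Icc_succ_top (by omega), sub_self, div_zero, add_zero,
      harmonicSum_zero, sub_zero, harmonicSum]
    refine Finset.sum_nbij' (fun c => m + 1 - c) (fun c => m + 1 - c) ?_ ?_ ?_ ?_ ?_
    · intro c hc
      simp only [Finset.mem_Icc] at *
      omega
    · intro c hc
      simp only [Finset.mem_Icc] at *
      omega
    · intro c hc
      simp only [Finset.mem_Icc] at *
      omega
    · intro c hc
      simp only [Finset.mem_Icc] at *
      omega
    · intro c hc
      simp only [Finset.mem_Icc] at hc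
      rw [Nat.cast_sub (by omega)]
  | succ r ih =>
    rw [← add_assoc, Finset.sum_Icc_succ_top (by omega), ih, harmonicSum_succ]
    push_cast
    have h1 : (r : ℝ) + 1 ≠ 0 := by positivity
    rw [show (m : ℝ) + 1 - (m + 1 + r + 1) = -(r + 1) by ring, div_neg]
    ring

/-- Partial fractions in c. Of the 3/(4a²), 1/(4a²) corrects the term c = a, and 1/(2a²) comes from
H_{a-1} = H_a - 1/a. -/
theorem sum_one_div_sub_mul_add {a k : ℕ} (ha : 1 ≤ a) (hk : a ≤ k) :
    ∑ c ∈ Finset.Icc 1 k, 1 / ((a : ℝ) - c) * (1 / ((a : ℝ) + c))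
      = 1 / (2 * (a : ℝ)) * (harmonicSum (k + a) - harmonicSum (k - a))
        - 3 / (4 * (a : ℝ) ^ 2) := by
  have ha0 : (a : ℝ) ≠ 0 := by positivity
  -- At c = a the left side is 0 because 1/0 = 0, while the decomposition still contributes
  -- (1/2a)(1/2a).
  have h1 : ∀ c ∈ Finset.Icc 1 k, 1 / ((a : ℝ) - c) * (1 / ((a : ℝ) + c))
      = 1 / (2 * (a : ℝ)) * (1 / ((a : ℝ) - c) + 1 / ((a : ℝ) + c))
        - if c = a then 1 / (4 * (a : ℝ) ^ 2) else 0 := by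
    intro c hc
    split_ifs with h
    · subst h
      rw [sub_self]
      field_simp
      ring
    · have h2 : (a : ℝ) - c ≠ 0 := sub_ne_zero.2 fun h' => h (by exact_mod_cast h'.symm)
      have h3 : (a : ℝ) + c ≠ 0 := by positivity
      field_simp
      ring
  rw [Finset.sum_congr rfl h1, Finset.sum_sub_distrib, ← Finset.mul_sum, Finset.sum_add_distrib,
    sum_one_div_add, Finset.sum_ite_eq' , if_pos (Finset.mem_Icc.2 ⟨ha, hk⟩)]
  obtain ⟨m, rfl⟩ : ∃ m, a = m + 1 := ⟨a - 1, by omega⟩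
  obtain ⟨r, rfl⟩ := Nat.exists_eq_add_of_le hk
  rw [sum_one_div_sub, harmonicSum_succ, Nat.add_sub_cancel_left]
  push_cast at ha0 ⊢
  field_simp
  ring

/-- Partial fractions in b work only for a ≠ c; the diagonal is carried separately. -/
theorem sum_middle_eq (k : ℕ) {a c : ℕ} (ha : 1 ≤ a) (hc : 1 ≤ c) :
    ∑ b ∈ Finset.Icc 1 k, 1 / (((a : ℝ) + b) * (b + c) * (a + c))
      = ((∑ b ∈ Finset.Icc 1 k, 1 / ((c : ℝ) + b)) - ∑ b ∈ Finset.Icc 1 k, 1 / ((a : ℝ) + b))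
          * (1 / ((a : ℝ) - c) * (1 / ((a : ℝ) + c)))
        + if c = a then 1 / (2 * (a : ℝ)) * ∑ b ∈ Finset.Icc 1 k, 1 / ((a : ℝ) + b) ^ 2
          else 0 := by
  split_ifs with h
  · subst h
    rw [sub_self, zero_mul, zero_add, Finset.mul_sum]
    refine Finset.sum_congr rfl fun b _ => ?_
    have h3 : (c : ℝ) + b ≠ 0 := by positivity
    have h4 : (b : ℝ) + c ≠ 0 := by positivity
    have h5 : (c : ℝ) ≠ 0 := by positivity
    rw [add_comm (b : ℝ) c]
    field_simp
    ring
  · rw [← Finset.sum_sub_distrib, Finset.sum_mul, add_zero]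
    refine Finset.sum_congr rfl fun b _ => ?_
    have h2 : (a : ℝ) - c ≠ 0 := sub_ne_zero.2 fun h' => h (by exact_mod_cast h'.symm)
    have h3 : (a : ℝ) + b ≠ 0 := by positivity
    have h4 : (b : ℝ) + c ≠ 0 := by positivity
    have h5 : (a : ℝ) + c ≠ 0 := by positivity
    rw [add_comm (c : ℝ) b]
    field_simp
    ring

/-- The truncated Tornheim sum `∑ 1 / (a b (a + b))`. -/
noncomputable def tornheimSum (k : ℕ) : ℝ :=
  ∑ a ∈ Finset.Icc 1 k, ∑ b ∈ Finset.Icc 1 k, 1 / ((a : ℝ) * b * (a + b))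

/-- The harmonic-number sum that becomes a Riemann sum after scaling. -/
noncomputable def harmonicRiemannSum (k : ℕ) : ℝ :=
  ∑ a ∈ Finset.Icc 1 k, 1 / (a : ℝ) * (harmonicSum (k + a) - harmonicSum a)
    * (harmonicSum (k + a) - harmonicSum (k - a))

/-- Uses 1/(ab(a+b)) = (1/a²)(1/b - 1/(a+b)). -/
theorem tornheimSum_eq (k : ℕ) : tornheimSum k
    = ∑ a ∈ Finset.Icc 1 k, 1 / (a : ℝ) ^ 2
        * (harmonicSum k - (harmonicSum (k + a) - harmonicSum a)) := by
  refine Finset.sum_congr rfl fun a ha => ?_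
  have ha' := (Finset.mem_Icc.1 ha).1
  have ha0 : (a : ℝ) ≠ 0 := by positivity
  rw [← sum_one_div_add, harmonicSum, ← Finset.sum_sub_distrib, Finset.mul_sum]
  refine Finset.sum_congr rfl fun b hb => ?_
  have hb' := (Finset.mem_Icc.1 hb).1
  have hb0 : (b : ℝ) ≠ 0 := by positivity
  have h3 : (a : ℝ) + b ≠ 0 := by positivity
  field_simp
  ring

/-- Uses 1/(ab(a+b)) = (1/a + 1/b)/(a+b)², whose two halves have equal sums. -/
theorem tornheimSum_eq_two_mul (k : ℕ) : tornheimSum k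
    = 2 * ∑ a ∈ Finset.Icc 1 k, 1 / (a : ℝ) * ∑ b ∈ Finset.Icc 1 k, 1 / ((a : ℝ) + b) ^ 2 := by
  have h1 : ∑ a ∈ Finset.Icc 1 k, 1 / (a : ℝ) * ∑ b ∈ Finset.Icc 1 k, 1 / ((a : ℝ) + b) ^ 2
      = ∑ a ∈ Finset.Icc 1 k, ∑ b ∈ Finset.Icc 1 k, 1 / (a : ℝ) * (1 / ((a : ℝ) + b) ^ 2) :=
    Finset.sum_congr rfl fun a _ => Finset.mul_sum _ _ _
  rw [two_mul]
  nth_rewrite 2 [h1]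
  rw [Finset.sum_comm, h1, ← Finset.sum_add_distrib, tornheimSum]
  refine Finset.sum_congr rfl fun a ha => ?_
  rw [← Finset.sum_add_distrib]
  refine Finset.sum_congr rfl fun b hb => ?_
  have ha' := (Finset.mem_Icc.1 ha).1
  have hb' := (Finset.mem_Icc.1 hb).1
  have ha0 : (a : ℝ) ≠ 0 := by positivity
  have hb0 : (b : ℝ) ≠ 0 := by positivity
  have h3 : (a : ℝ) + b ≠ 0 := by positivity
  rw [add_comm (b : ℝ) a]
  field_simp
  ring

theorem symmetric_sum_eq (k : ℕ) :
    ∑ a ∈ Finset.Icc 1 k, ∑ b ∈ Finset.Icc 1 k, ∑ c ∈ Finset.Icc 1 k,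
        1 / (((a : ℝ) + b) * (b + c) * (a + c))
      = -harmonicRiemannSum k
        + 3 / 2 * harmonicSum k * (∑ a ∈ Finset.Icc 1 k, 1 / (a : ℝ) ^ 2)
        - 5 / 4 * tornheimSum k := by
  set h : ℕ → ℝ := fun a => ∑ b ∈ Finset.Icc 1 k, 1 / ((a : ℝ) + b) with hh
  set w : ℕ → ℕ → ℝ := fun a c => 1 / ((a : ℝ) - c) * (1 / ((a : ℝ) + c)) with hw
  set q : ℕ → ℝ := fun a => 1 / (2 * (a : ℝ)) * ∑ b ∈ Finset.Icc 1 k, 1 / ((a : ℝ) + b) ^ 2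
    with hq
  have h1 : ∑ a ∈ Finset.Icc 1 k, ∑ b ∈ Finset.Icc 1 k, ∑ c ∈ Finset.Icc 1 k,
        1 / (((a : ℝ) + b) * (b + c) * (a + c))
      = ∑ a ∈ Finset.Icc 1 k, ∑ c ∈ Finset.Icc 1 k,
        (h c * w a c - h a * w a c + if c = a then q a else 0) := by
    refine Finset.sum_congr rfl fun a ha => ?_
    rw [Finset.sum_comm]
    refine Finset.sum_congr rfl fun c hc => ?_
    rw [sum_middle_eq k (Finset.mem_Icc.1 ha).1 (Finset.mem_Icc.1 hc).1, sub_mul]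
  -- The kernel `w` is antisymmetric, so only the sum weighted by `h a` is needed, and there c sums
  -- in closed form.
  have h2 : ∑ a ∈ Finset.Icc 1 k, ∑ c ∈ Finset.Icc 1 k, h c * w a c
      = -∑ a ∈ Finset.Icc 1 k, ∑ c ∈ Finset.Icc 1 k, h a * w a c := by
    rw [Finset.sum_comm, ← Finset.sum_neg_distrib]
    refine Finset.sum_congr rfl fun a _ => ?_
    rw [← Finset.sum_neg_distrib]
    refine Finset.sum_congr rfl fun c _ => ?_
    simp only [hw]
    rw [← neg_sub (a : ℝ) c, add_comm (c : ℝ) a, div_neg]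
    ring
  have h3 : ∑ a ∈ Finset.Icc 1 k, ∑ c ∈ Finset.Icc 1 k, (if c = a then q a else 0)
      = 1 / 4 * tornheimSum k := by
    rw [tornheimSum_eq_two_mul, ← mul_assoc, Finset.mul_sum]
    refine Finset.sum_congr rfl fun a ha => ?_
    rw [Finset.sum_ite_eq', if_pos ha]
    simp only [hq]
    ring
  have h4 : ∑ a ∈ Finset.Icc 1 k, ∑ c ∈ Finset.Icc 1 k, h a * w a c
      = 1 / 2 * harmonicRiemannSum k
        - 3 / 4 * ∑ a ∈ Finset.Icc 1 k, 1 / (a : ℝ) ^ 2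
            * (harmonicSum (k + a) - harmonicSum a) := by
    rw [harmonicRiemannSum, Finset.mul_sum, Finset.mul_sum, ← Finset.sum_sub_distrib]
    refine Finset.sum_congr rfl fun a ha => ?_
    obtain ⟨ha1, ha2⟩ := Finset.mem_Icc.1 ha
    have ha0 : (a : ℝ) ≠ 0 := by positivity
    rw [← Finset.mul_sum]
    simp only [hw, hh]
    rw [sum_one_div_sub_mul_add ha1 ha2, sum_one_div_add]
    field_simp
  have h5 : ∑ a ∈ Finset.Icc 1 k, 1 / (a : ℝ) ^ 2 * (harmonicSum (k + a) - harmonicSum a)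
      = harmonicSum k * (∑ a ∈ Finset.Icc 1 k, 1 / (a : ℝ) ^ 2) - tornheimSum k := by
    rw [tornheimSum_eq, Finset.mul_sum, ← Finset.sum_sub_distrib]
    refine Finset.sum_congr rfl fun a _ => ?_
    ring
  rw [h1]
  simp only [Finset.sum_add_distrib, Finset.sum_sub_distrib]
  rw [h2, h3, h4, h5]
  ring

/-! ### Asymptotics of the harmonic factor. -/

theorem tendsto_harmonicSum_sub_log :
    Tendsto (fun n : ℕ => harmonicSum n - Real.log n) atTop
      (𝓝 Real.eulerMascheroniConstant) := by
  simpa only [harmonicSum_eq_harmonic] using Real.tendsto_harmonic_sub_log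

theorem harmonicSum_sub_le {m n : ℕ} (hm : 1 ≤ m) (hmn : m ≤ n) :
    harmonicSum n - harmonicSum m ≤ Real.log n - Real.log m := by
  have h := Real.strictAnti_eulerMascheroniSeq'.antitone hmn
  rw [Real.eulerMascheroniSeq', Real.eulerMascheroniSeq', if_neg (by omega), if_neg (by omega),
    ← harmonicSum_eq_harmonic, ← harmonicSum_eq_harmonic] at h
  linarith

theorem harmonicSum_mono : Monotone harmonicSum :=
  monotone_nat_of_le_succ fun n => by
    rw [harmonicSum_succ]
    have : 0 ≤ 1 / ((n : ℝ) + 1) := by positivity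
    linarith

theorem sum_Icc_one_div_pow (k p : ℕ) :
    ∑ a ∈ Finset.Icc 1 k, 1 / (a : ℝ) ^ p = ∑ n ∈ Finset.range k, 1 / ((n : ℝ) + 1) ^ p := by
  induction k with
  | zero => simp
  | succ k ih =>
    rw [Finset.sum_Icc_succ_top (by omega), ih, Finset.sum_range_succ]
    push_cast
    ring

theorem tendsto_sum_one_div_sq :
    Tendsto (fun k : ℕ => ∑ a ∈ Finset.Icc 1 k, 1 / (a : ℝ) ^ 2) atTop (𝓝 zetaTwo) := by
  simp_rw [sum_Icc_one_div_pow]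
  exact hasSum_zetaTwo.tendsto_sum_nat

theorem sum_one_div_sq_le_zetaTwo (k : ℕ) :
    ∑ a ∈ Finset.Icc 1 k, 1 / (a : ℝ) ^ 2 ≤ zetaTwo := by
  rw [sum_Icc_one_div_pow]
  exact hasSum_zetaTwo.summable.sum_le_tsum _ (fun n _ => by positivity)

theorem zetaTwo_le_sum_add (k : ℕ) :
    zetaTwo ≤ ∑ a ∈ Finset.Icc 1 (k + 1), 1 / (a : ℝ) ^ 2 + 1 / ((k : ℝ) + 1) := by
  -- The right side decreases to ζ(2), because 1/(n+2)² ≤ 1/(n+1) - 1/(n+2).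
  have ha : Antitone fun k : ℕ =>
      ∑ a ∈ Finset.Icc 1 (k + 1), 1 / (a : ℝ) ^ 2 + 1 / ((k : ℝ) + 1) := by
    refine antitone_nat_of_succ_le fun n => ?_
    rw [Finset.sum_Icc_succ_top (by omega)]
    push_cast
    have h : 1 / ((n : ℝ) + 1 + 1) ^ 2 + 1 / ((n : ℝ) + 1 + 1) ≤ 1 / ((n : ℝ) + 1) := by
      rw [div_add_div _ _ (by positivity) (by positivity), div_le_div_iff₀ (by positivity)
        (by positivity)]
      have : (0 : ℝ) ≤ n := n.cast_nonneg
      nlinarith [mul_nonneg this this]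
    linarith
  refine ha.le_of_tendsto ?_ k
  have h1 := (tendsto_add_atTop_iff_nat 1).2 tendsto_sum_one_div_sq
  simpa using h1.add tendsto_one_div_add_atTop_nhds_zero_nat

theorem tendsto_log_div_nat : Tendsto (fun k : ℕ => Real.log k / k) atTop (𝓝 0) :=
  Real.isLittleO_log_id_atTop.tendsto_div_nhds_zero.comp tendsto_natCast_atTop_atTop

theorem tendsto_harmonicSum_div : Tendsto (fun k : ℕ => harmonicSum k / k) atTop (𝓝 0) := by
  have h1 := tendsto_harmonicSum_sub_log.mul (tendsto_one_div_atTop_nhds_zero_nat (𝕜 := ℝ))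
  have h2 := h1.add tendsto_log_div_nat
  simp only [mul_zero, add_zero] at h2
  refine h2.congr fun k => ?_
  ring

/-- Completing the partial sum to ζ(2) costs at most H_k/k, which tends to 0. -/
theorem tendsto_harmonicSum_mul_sum :
    Tendsto (fun k : ℕ => harmonicSum k * (∑ a ∈ Finset.Icc 1 k, 1 / (a : ℝ) ^ 2)
      - zetaTwo * Real.log k) atTop (𝓝 (zetaTwo * Real.eulerMascheroniConstant)) := by
  have hH : ∀ k, 0 ≤ harmonicSum k := fun k => Finset.sum_nonneg fun i _ => by positivity
  have h1 : Tendsto (fun k : ℕ => harmonicSum k *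
      (zetaTwo - ∑ a ∈ Finset.Icc 1 k, 1 / (a : ℝ) ^ 2)) atTop (𝓝 0) := by
    refine tendsto_of_tendsto_of_tendsto_of_le_of_le' tendsto_const_nhds tendsto_harmonicSum_div
      (Eventually.of_forall fun k => mul_nonneg (hH k) (by
        linarith [sum_one_div_sq_le_zetaTwo k])) ?_
    filter_upwards [eventually_ge_atTop 1] with k hk
    obtain ⟨m, rfl⟩ := Nat.exists_eq_add_of_le' hk
    have h := zetaTwo_le_sum_add m
    rw [div_eq_mul_one_div]
    refine mul_le_mul_of_nonneg_left ?_ (hH _)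
    push_cast
    linarith
  have h2 := (tendsto_harmonicSum_sub_log.const_mul zetaTwo).sub h1
  rw [sub_zero] at h2
  refine h2.congr fun k => ?_
  ring

theorem sum_pow_div_le_neg_log {u : ℝ} (hu : u ∈ Ioo (0 : ℝ) 1) (k : ℕ) :
    ∑ n ∈ Finset.range k, u ^ (n + 1) / ((n : ℝ) + 1) ≤ -Real.log (1 - u) := by
  have h := Real.hasSum_pow_div_log_of_abs_lt_one (x := u) (by rw [abs_of_pos hu.1]; exact hu.2)
  have := hu.1
  exact sum_le_hasSum _ (fun n _ => by positivity) h

/-! ### Limit of the Tornheim sum. -/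

/-- Writing 1/(a+b) = ∫ u^(a+b-1) du makes the double sum a square, whose base increases to
-log(1-u). -/
theorem tornheimSum_eq_integral (k : ℕ) : tornheimSum k
    = ∫ u in Ioo (0 : ℝ) 1, (∑ n ∈ Finset.range k, u ^ (n + 1) / ((n : ℝ) + 1)) ^ 2 / u := by
  have h1 : ∀ u ∈ Ioo (0 : ℝ) 1, (∑ n ∈ Finset.range k, u ^ (n + 1) / ((n : ℝ) + 1)) ^ 2 / u
      = ∑ n ∈ Finset.range k, ∑ m ∈ Finset.range k,
        1 / (((n : ℝ) + 1) * ((m : ℝ) + 1)) * u ^ (n + m + 1) := by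
    intro u hu
    have hu0 := hu.1.ne'
    rw [sq, Finset.sum_mul_sum, Finset.sum_div]
    refine Finset.sum_congr rfl fun n _ => ?_
    rw [Finset.sum_div]
    refine Finset.sum_congr rfl fun m _ => ?_
    have : (n : ℝ) + 1 ≠ 0 := by positivity
    have : (m : ℝ) + 1 ≠ 0 := by positivity
    field_simp
    ring
  have hint : ∀ n m : ℕ, Integrable (fun u : ℝ =>
      1 / (((n : ℝ) + 1) * ((m : ℝ) + 1)) * u ^ (n + m + 1)) (volume.restrict (Ioo 0 1)) :=
    fun n m => ((hasUnitIntegral_pow (n + m + 1)).const_mul _).1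
  rw [setIntegral_congr_fun measurableSet_Ioo h1,
    integral_finsetSum _ fun n _ => integrable_finsetSum _ fun m _ => hint n m]
  have h2 : ∀ n ∈ Finset.range k, ∫ u in Ioo (0 : ℝ) 1, ∑ m ∈ Finset.range k,
      1 / (((n : ℝ) + 1) * ((m : ℝ) + 1)) * u ^ (n + m + 1)
      = ∑ m ∈ Finset.range k,
        1 / (((n : ℝ) + 1) * ((m : ℝ) + 1) * (((n : ℝ) + 1) + ((m : ℝ) + 1))) := by
    intro n _
    rw [integral_finsetSum _ fun m _ => hint n m]
    refine Finset.sum_congr rfl fun m _ => ?_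
    rw [((hasUnitIntegral_pow (n + m + 1)).const_mul _).2]
    push_cast
    rw [one_div_mul_one_div]
    congr 2
    ring
  rw [Finset.sum_congr rfl h2, tornheimSum]
  have h3 : ∀ f : ℕ → ℝ, ∑ a ∈ Finset.Icc 1 k, f a = ∑ n ∈ Finset.range k, f (n + 1) := by
    intro f
    rw [Finset.range_eq_Ico, Finset.sum_Ico_add' f 0 k 1]
    rfl
  rw [h3]
  refine Finset.sum_congr rfl fun n _ => ?_
  rw [h3]
  push_cast
  rfl

theorem tendsto_tornheimSum : Tendsto tornheimSum atTop (𝓝 (2 * zetaThree)) := by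
  rw [← hasUnitIntegral_log_one_sub_sq.2, funext tornheimSum_eq_integral]
  refine tendsto_integral_of_dominated_convergence _ (fun k => ?_)
    hasUnitIntegral_log_one_sub_sq.1 (fun k => ?_) ?_
  · exact Measurable.aestronglyMeasurable (by fun_prop)
  · refine ae_restrict_of_forall_mem measurableSet_Ioo fun u hu => ?_
    have hu0 := hu.1
    rw [Real.norm_of_nonneg (by positivity)]
    refine div_le_div_of_nonneg_right ?_ hu0.le
    rw [← neg_sq (Real.log (1 - u))]
    exact pow_le_pow_left₀ (Finset.sum_nonneg fun n _ => by positivity)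
      (sum_pow_div_le_neg_log hu k) 2
  · refine ae_restrict_of_forall_mem measurableSet_Ioo fun u hu => ?_
    have h := Real.hasSum_pow_div_log_of_abs_lt_one (x := u)
      (by rw [abs_of_pos hu.1]; exact hu.2)
    have h2 := (h.tendsto_sum_nat.pow 2).div_const u
    rwa [neg_sq] at h2

/-! ### Limit of the harmonic Riemann sum. -/

/-- A sum over `1 ≤ a ≤ k` is the integral of a step function on `(0, 1)`. -/
theorem integral_comp_ceil (g : ℕ → ℝ) {k : ℕ} (hk : 1 ≤ k) :
    ∫ t in Ioo (0 : ℝ) 1, g ⌈(k : ℝ) * t⌉₊ = (1 / (k : ℝ)) * ∑ a ∈ Finset.Icc 1 k, g a := by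
  have hk0 : (0 : ℝ) < k := by positivity
  have hle : ∀ i : ℕ, (i : ℝ) / k ≤ ((i + 1 : ℕ) : ℝ) / k := fun i => by
    gcongr
    simp
  have hc : ∀ i : ℕ, ∀ t ∈ Ioc ((i : ℝ) / k) (((i + 1 : ℕ) : ℝ) / k),
      g ⌈(k : ℝ) * t⌉₊ = g (i + 1) := by
    intro i t ht
    congr 1
    rw [Nat.ceil_eq_iff (by omega)]
    rw [mem_Ioc, div_lt_iff₀ hk0, le_div_iff₀ hk0] at ht
    constructor
    · simpa [mul_comm] using ht.1
    · rw [mul_comm]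
      exact ht.2
  have hi : ∀ i < k, IntervalIntegrable (fun t : ℝ => g ⌈(k : ℝ) * t⌉₊) volume
      ((i : ℝ) / k) (((i + 1 : ℕ) : ℝ) / k) := by
    intro i _
    rw [intervalIntegrable_iff_integrableOn_Ioc_of_le (hle i)]
    exact (integrableOn_const (C := g (i + 1)) (by simp)).congr_fun
      (fun t ht => (hc i t ht).symm) measurableSet_Ioc
  have h1 := intervalIntegral.sum_integral_adjacent_intervals hi
  rw [Nat.cast_zero, zero_div, div_self hk0.ne', intervalIntegral.integral_of_le zero_le_one,
    integral_Ioc_eq_integral_Ioo] at h1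
  rw [← h1, Finset.mul_sum]
  have h3 : ∀ f : ℕ → ℝ, ∑ a ∈ Finset.Icc 1 k, f a = ∑ n ∈ Finset.range k, f (n + 1) := by
    intro f
    rw [Finset.range_eq_Ico, Finset.sum_Ico_add' f 0 k 1]
    rfl
  rw [h3]
  refine Finset.sum_congr rfl fun i _ => ?_
  rw [intervalIntegral.integral_of_le (hle i), setIntegral_congr_fun measurableSet_Ioc (hc i),
    setIntegral_const]
  simp only [Measure.real, Real.volume_Ioc, smul_eq_mul]
  rw [ENNReal.toReal_ofReal (sub_nonneg.2 (hle i))]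
  push_cast
  ring

/-- The difference is at most log((k+a)/a) ≤ log(2/t) ≤ 4 (2/t)^(1/4). A small exponent keeps the
final majorant integrable. -/
theorem harmonicSum_sub_le_rpow {a k : ℕ} {t : ℝ} (ht : t ∈ Ioo (0 : ℝ) 1) (ha : 1 ≤ a)
    (hak : a ≤ k) (hta : k * t ≤ a) :
    harmonicSum (k + a) - harmonicSum a ≤ 8 * t ^ (-(1 / 4) : ℝ) := by
  have ht0 := ht.1
  have ha0 : (0 : ℝ) < a := by positivity
  have hak' : (a : ℝ) ≤ k := by exact_mod_cast hak
  have hk0 : (0 : ℝ) < k := by linarith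
  have h1 : Real.log ((k + a : ℕ) : ℝ) - Real.log a ≤ Real.log (2 / t) := by
    rw [← Real.log_div (by positivity) ha0.ne']
    refine Real.log_le_log (by positivity) ?_
    rw [div_le_div_iff₀ ha0 ht0]
    push_cast
    nlinarith [ht.2]
  have h2 : Real.log (2 / t) ≤ (2 / t) ^ (1 / 4 : ℝ) / (1 / 4) :=
    Real.log_le_rpow_div (by positivity) (by norm_num)
  have h3 : (2 / t) ^ (1 / 4 : ℝ) = 2 ^ (1 / 4 : ℝ) * t ^ (-(1 / 4) : ℝ) := by
    rw [Real.div_rpow (by norm_num) ht0.le, Real.rpow_neg ht0.le]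
    rfl
  have h4 : (2 : ℝ) ^ (1 / 4 : ℝ) ≤ 2 := by
    calc (2 : ℝ) ^ (1 / 4 : ℝ) ≤ 2 ^ (1 : ℝ) :=
          Real.rpow_le_rpow_of_exponent_le (by norm_num) (by norm_num)
      _ = 2 := Real.rpow_one 2
  have h5 : 0 ≤ t ^ (-(1 / 4) : ℝ) := by positivity
  rw [h3] at h2
  have h6 := harmonicSum_sub_le ha (Nat.le_add_left a k)
  nlinarith [mul_le_mul_of_nonneg_right h4 h5]

/-- The factor a absorbs the 1/a of the Riemann sum, and the singularity at a = k is only an inverse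
square root. -/
theorem harmonicSum_sub_sub_le {a k : ℕ} (ha : 1 ≤ a) (hak : a ≤ k) :
    harmonicSum (k + a) - harmonicSum (k - a)
      ≤ 5 * a / (√(k : ℝ) * √((k : ℝ) - a + 1)) := by
  obtain ⟨d, rfl⟩ := Nat.exists_eq_add_of_le' hak
  have ha1 : (1 : ℝ) ≤ a := by exact_mod_cast ha
  have hd0 : (0 : ℝ) ≤ d := d.cast_nonneg
  rw [Nat.add_sub_cancel]
  push_cast
  rw [add_sub_cancel_right]
  set s := √((d : ℝ) + 1) with hs
  set r := √((d : ℝ) + a) with hr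
  set w := √((d : ℝ) + a + a) with hw
  have hs2 : s ^ 2 = (d : ℝ) + 1 := Real.sq_sqrt (by positivity)
  have hr2 : r ^ 2 = (d : ℝ) + a := Real.sq_sqrt (by positivity)
  have hw2 : w ^ 2 = (d : ℝ) + a + a := Real.sq_sqrt (by positivity)
  have hs0 : 0 < s := Real.sqrt_pos.2 (by positivity)
  have hr0 : 0 < r := Real.sqrt_pos.2 (by positivity)
  have hw0 : 0 < w := Real.sqrt_pos.2 (by positivity)
  have hrw : r ≤ w := Real.sqrt_le_sqrt (by linarith)
  -- Here d = k - a may be 0, so the logarithmic comparison starts at d + 1; the omitted term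
  -- 1/(d+1) turns the constant 4 into 5.
  have h1 : harmonicSum (d + a + a) - harmonicSum (d + 1)
      ≤ Real.log ((d : ℝ) + a + a) - Real.log ((d : ℝ) + 1) := by
    simpa using harmonicSum_sub_le (m := d + 1) (n := d + a + a) (by omega) (by omega)
  have h2 : Real.log ((d : ℝ) + a + a) - Real.log ((d : ℝ) + 1) ≤ 2 * (w / s - 1) := by
    rw [← hs2, ← hw2, Real.log_pow, Real.log_pow]
    have := Real.log_le_sub_one_of_pos (div_pos hw0 hs0)
    rw [Real.log_div hw0.ne' hs0.ne'] at this
    push_cast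
    linarith
  have h3 : 2 * (w / s - 1) ≤ 4 * a / (r * s) := by
    rw [div_sub_one hs0.ne', ← mul_div_assoc, div_le_div_iff₀ hs0 (by positivity)]
    have h5 : (w - s) * r ≤ 2 * a := by
      have h6 : (w - s) * w ≤ 2 * a := by
        have : s ≤ w := Real.sqrt_le_sqrt (by linarith)
        nlinarith
      have : 0 ≤ w - s := sub_nonneg.2 (Real.sqrt_le_sqrt (by linarith))
      nlinarith
    nlinarith
  have h4 : 1 / ((d : ℝ) + 1) ≤ a / (r * s) := by
    rw [← hs2, div_le_div_iff₀ (by positivity) (by positivity)]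
    have h7 : r ≤ a * s := by
      refine Real.sqrt_le_iff.2 ⟨by positivity, ?_⟩
      rw [mul_pow, hs2]
      nlinarith [mul_nonneg hd0 (sub_nonneg.2 ha1)]
    nlinarith
  have h5 := harmonicSum_succ d
  have h6 : 5 * (a : ℝ) / (r * s) = 4 * a / (r * s) + a / (r * s) := by ring
  linarith

theorem integrableOn_rpow_add :
    IntegrableOn (fun t : ℝ => 40 * (t ^ (-(3 / 4) : ℝ) + (1 - t) ^ (-(3 / 4) : ℝ)))
      (Ioo 0 1) := by
  have h1 : IntervalIntegrable (fun t : ℝ => t ^ (-(3 / 4) : ℝ)) volume 0 1 :=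
    intervalIntegral.intervalIntegrable_rpow' (by norm_num)
  have h2 : IntervalIntegrable (fun t : ℝ => (1 - t) ^ (-(3 / 4) : ℝ)) volume 0 1 := by
    simpa using (h1.comp_sub_left 1).symm
  exact ((intervalIntegrable_iff_integrableOn_Ioo_of_le zero_le_one).1 ((h1.add h2).const_mul 40))

/-- The integrand whose Riemann sums are `harmonicRiemannSum`. -/
noncomputable def harmonicRiemannTerm (k a : ℕ) : ℝ :=
  k / a * (harmonicSum (k + a) - harmonicSum a) * (harmonicSum (k + a) - harmonicSum (k - a))

theorem harmonicRiemannSum_eq_integral {k : ℕ} (hk : 1 ≤ k) : harmonicRiemannSum k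
    = ∫ t in Ioo (0 : ℝ) 1, harmonicRiemannTerm k ⌈(k : ℝ) * t⌉₊ := by
  rw [integral_comp_ceil (harmonicRiemannTerm k) hk, harmonicRiemannSum, Finset.mul_sum]
  refine Finset.sum_congr rfl fun a _ => ?_
  have : (k : ℝ) ≠ 0 := by positivity
  rw [harmonicRiemannTerm]
  field_simp

theorem ceil_mul_mem {k : ℕ} (hk : 1 ≤ k) {t : ℝ} (ht : t ∈ Ioo (0 : ℝ) 1) :
    1 ≤ ⌈(k : ℝ) * t⌉₊ ∧ ⌈(k : ℝ) * t⌉₊ ≤ k := by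
  have hk0 : (0 : ℝ) < k := by positivity
  exact ⟨Nat.one_le_ceil_iff.2 (mul_pos hk0 ht.1), Nat.ceil_le.2 (by nlinarith [ht.2])⟩

theorem norm_harmonicRiemannTerm_le {k : ℕ} (hk : 1 ≤ k) {t : ℝ} (ht : t ∈ Ioo (0 : ℝ) 1) :
    ‖harmonicRiemannTerm k ⌈(k : ℝ) * t⌉₊‖
      ≤ 40 * (t ^ (-(3 / 4) : ℝ) + (1 - t) ^ (-(3 / 4) : ℝ)) := by
  obtain ⟨ha, hak⟩ := ceil_mul_mem hk ht
  have hta := Nat.le_ceil ((k : ℝ) * t)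
  have hta2 := Nat.ceil_lt_add_one (mul_nonneg (k.cast_nonneg : (0 : ℝ) ≤ k) ht.1.le)
  set a := ⌈(k : ℝ) * t⌉₊
  have hk0 : (0 : ℝ) < k := by positivity
  have ha0 : (0 : ℝ) < a := by positivity
  have ht0 := ht.1
  have ht1 : 0 < 1 - t := sub_pos.2 ht.2
  set x := t ^ (-(1 / 4) : ℝ) with hx
  set y := (1 - t) ^ (-(1 / 4) : ℝ) with hy
  have hx0 : 0 < x := Real.rpow_pos_of_pos ht0 _
  have hy0 : 0 < y := Real.rpow_pos_of_pos ht1 _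
  have hx3 : t ^ (-(3 / 4) : ℝ) = x ^ 3 := by
    rw [hx, ← Real.rpow_natCast, ← Real.rpow_mul ht0.le]
    norm_num
  have hy3 : (1 - t) ^ (-(3 / 4) : ℝ) = y ^ 3 := by
    rw [hy, ← Real.rpow_natCast, ← Real.rpow_mul ht1.le]
    norm_num
  have hy2 : 1 / √(1 - t) = y ^ 2 := by
    rw [hy, ← Real.rpow_natCast, ← Real.rpow_mul ht1.le, Real.sqrt_eq_rpow, one_div,
      ← Real.rpow_neg ht1.le]
    norm_num
  have h1 : 0 ≤ harmonicSum (k + a) - harmonicSum a :=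
    sub_nonneg.2 (harmonicSum_mono (by omega))
  have h2 : 0 ≤ harmonicSum (k + a) - harmonicSum (k - a) :=
    sub_nonneg.2 (harmonicSum_mono (by omega))
  have h3 := harmonicSum_sub_le_rpow ht ha hak hta
  have h4 : k / a * (harmonicSum (k + a) - harmonicSum (k - a)) ≤ 5 * y ^ 2 := by
    have hs : √(k : ℝ) * √(1 - t) ≤ √((k : ℝ) - a + 1) := by
      rw [← Real.sqrt_mul hk0.le]
      refine Real.sqrt_le_sqrt ?_
      linarith
    have hk1 : 0 < √(k : ℝ) := Real.sqrt_pos.2 hk0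
    have ht2 : 0 < √(1 - t) := Real.sqrt_pos.2 ht1
    calc k / a * (harmonicSum (k + a) - harmonicSum (k - a))
        ≤ k / a * (5 * a / (√(k : ℝ) * √((k : ℝ) - a + 1))) :=
          mul_le_mul_of_nonneg_left (harmonicSum_sub_sub_le ha hak) (by positivity)
      _ ≤ k / a * (5 * a / (√(k : ℝ) * (√(k : ℝ) * √(1 - t)))) := by gcongr
      _ = 5 * (1 / √(1 - t)) * (k / (√(k : ℝ) * √(k : ℝ))) := by field_simp
      _ = 5 * y ^ 2 := by rw [Real.mul_self_sqrt hk0.le, div_self hk0.ne', hy2, mul_one]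
  rw [harmonicRiemannTerm, Real.norm_of_nonneg (by positivity), hx3, hy3]
  calc k / a * (harmonicSum (k + a) - harmonicSum a) * (harmonicSum (k + a) - harmonicSum (k - a))
      = (harmonicSum (k + a) - harmonicSum a)
        * (k / a * (harmonicSum (k + a) - harmonicSum (k - a))) := by ring
    _ ≤ (8 * x) * (5 * y ^ 2) := by gcongr
    _ ≤ 40 * (x ^ 3 + y ^ 3) := by
      -- This separates the singularities at 0 and 1, each with integrable exponent -3/4.
      have : x * y ^ 2 ≤ x ^ 3 + y ^ 3 := by
        rcases le_total x y with h | h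
        · nlinarith [mul_le_mul_of_nonneg_right h (sq_nonneg y), pow_pos hx0 3]
        · nlinarith [mul_le_mul_of_nonneg_left (pow_le_pow_left₀ hy0.le h 2) hx0.le,
            pow_pos hy0 3]
      linarith

/-- With a = ⌈kt⌉ the ratio a/k tends to t; in each difference of harmonic numbers γ and log k
cancel. -/
theorem tendsto_harmonicRiemannTerm {t : ℝ} (ht : t ∈ Ioo (0 : ℝ) 1) :
    Tendsto (fun k : ℕ => harmonicRiemannTerm k ⌈(k : ℝ) * t⌉₊) atTop
      (𝓝 ((Real.log (1 + t) - Real.log t) * (Real.log (1 + t) - Real.log (1 - t)) / t)) := by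
  have ht0 := ht.1
  have ht1 : 0 < 1 - t := sub_pos.2 ht.2
  set a : ℕ → ℕ := fun k => ⌈(k : ℝ) * t⌉₊ with ha
  have hdiv : Tendsto (fun k : ℕ => (a k : ℝ) / k) atTop (𝓝 t) := by
    have := (tendsto_nat_ceil_mul_div_atTop ht0.le).comp tendsto_natCast_atTop_atTop
    refine this.congr fun k => ?_
    simp [ha, mul_comm]
  have hatop : Tendsto a atTop atTop :=
    tendsto_nat_ceil_atTop.comp (tendsto_natCast_atTop_atTop.atTop_mul_const ht0)
  have hadd : Tendsto (fun k => k + a k) atTop atTop :=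
    tendsto_atTop_mono (fun k => Nat.le_add_right k _) tendsto_id
  have hsub : Tendsto (fun k => k - a k) atTop atTop := by
    rw [← tendsto_natCast_atTop_iff (R := ℝ)]
    have h : Tendsto (fun k : ℕ => (k : ℝ) * (1 - t) - 1) atTop atTop :=
      tendsto_atTop_add_const_right _ _ (tendsto_natCast_atTop_atTop.atTop_mul_const ht1)
    refine tendsto_atTop_mono' _ ?_ h
    filter_upwards [eventually_ge_atTop 1] with k hk
    rw [Nat.cast_sub (ceil_mul_mem hk ht).2]
    have := Nat.ceil_lt_add_one (mul_nonneg (k.cast_nonneg : (0 : ℝ) ≤ k) ht.1.le)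
    linarith
  have e1 := tendsto_harmonicSum_sub_log.comp hadd
  have e2 := tendsto_harmonicSum_sub_log.comp hatop
  have e3 := tendsto_harmonicSum_sub_log.comp hsub
  have l1 := (Real.continuousAt_log (x := 1 + t) (by positivity)).tendsto.comp
    (hdiv.const_add 1)
  have l2 := (Real.continuousAt_log (x := t) ht0.ne').tendsto.comp hdiv
  have l3 := (Real.continuousAt_log (x := 1 - t) ht1.ne').tendsto.comp (hdiv.const_sub 1)
  have m1 := (e1.sub e2).add (l1.sub l2)
  have m2 := (e1.sub e3).add (l1.sub l3)
  rw [sub_self, zero_add] at m1 m2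
  have m3 := ((hdiv.inv₀ ht0.ne').mul m1).mul m2
  have hlim : t⁻¹ * (Real.log (1 + t) - Real.log t) * (Real.log (1 + t) - Real.log (1 - t))
      = (Real.log (1 + t) - Real.log t) * (Real.log (1 + t) - Real.log (1 - t)) / t := by ring
  rw [hlim] at m3
  refine m3.congr' ?_
  filter_upwards [eventually_ge_atTop 1, hsub.eventually_ge_atTop 1] with k hk hk2
  obtain ⟨h1, h2⟩ := ceil_mul_mem hk ht
  change 1 ≤ a k at h1
  change a k ≤ k at h2
  have hk0 : (k : ℝ) ≠ 0 := by positivity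
  have ha0 : (a k : ℝ) ≠ 0 := by positivity
  have hs0 : (k : ℝ) - a k ≠ 0 := by
    rw [← Nat.cast_sub h2]
    positivity
  have hp0 : (k : ℝ) + a k ≠ 0 := by positivity
  have q1 : Real.log (1 + a k / k) = Real.log ((k + a k : ℕ) : ℝ) - Real.log k := by
    push_cast
    rw [← Real.log_div hp0 hk0]
    congr 1
    field_simp
  have q2 : Real.log (a k / k) = Real.log (a k) - Real.log k := Real.log_div ha0 hk0
  have q3 : Real.log (1 - a k / k) = Real.log ((k - a k : ℕ) : ℝ) - Real.log k := by
    rw [Nat.cast_sub h2, ← Real.log_div hs0 hk0]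
    congr 1
    field_simp
  simp only [Function.comp_apply]
  rw [q1, q2, q3, harmonicRiemannTerm]
  change _ = k / (a k : ℝ) * (harmonicSum (k + a k) - harmonicSum (a k))
    * (harmonicSum (k + a k) - harmonicSum (k - a k))
  rw [inv_div]
  ring

theorem tendsto_harmonicRiemannSum : Tendsto harmonicRiemannSum atTop
    (𝓝 (∫ t in Ioo (0 : ℝ) 1,
      (Real.log (1 + t) - Real.log t) * (Real.log (1 + t) - Real.log (1 - t)) / t)) := by
  have h : Tendsto (fun k : ℕ => ∫ t in Ioo (0 : ℝ) 1, harmonicRiemannTerm k ⌈(k : ℝ) * t⌉₊)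
      atTop (𝓝 (∫ t in Ioo (0 : ℝ) 1,
        (Real.log (1 + t) - Real.log t) * (Real.log (1 + t) - Real.log (1 - t)) / t)) := by
    refine tendsto_integral_filter_of_dominated_convergence _ (Eventually.of_forall fun k => ?_)
      ?_ integrableOn_rpow_add ?_
    · exact ((measurable_of_countable (harmonicRiemannTerm k)).comp
        (measurable_const.mul measurable_id).nat_ceil).aestronglyMeasurable
    · filter_upwards [eventually_ge_atTop 1] with k hk
      exact ae_restrict_of_forall_mem measurableSet_Ioo fun t ht =>
        norm_harmonicRiemannTerm_le hk ht
    · exact ae_restrict_of_forall_mem measurableSet_Ioo fun t ht =>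
        tendsto_harmonicRiemannTerm ht
  refine h.congr' ?_
  filter_upwards [eventually_ge_atTop 1] with k hk
  exact (harmonicRiemannSum_eq_integral hk).symm

/-! ### Symmetrization of the triple integral. -/

section Symmetrization

variable {μ : Measure ℝ} [SFinite μ]

theorem lintegral₃_swap_left {w : ℝ → ℝ → ℝ → ENNReal}
    (hw : Measurable fun p : ℝ × ℝ × ℝ => w p.1 p.2.1 p.2.2) :
    ∫⁻ x, ∫⁻ y, ∫⁻ z, w y x z ∂μ ∂μ ∂μ = ∫⁻ x, ∫⁻ y, ∫⁻ z, w x y z ∂μ ∂μ ∂μ := by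
  rw [lintegral_lintegral_swap]
  have h : Measurable fun q : (ℝ × ℝ) × ℝ => w q.1.2 q.1.1 q.2 :=
    hw.comp (measurable_fst.snd.prodMk (measurable_fst.fst.prodMk measurable_snd))
  exact h.lintegral_prod_right'.aemeasurable

theorem lintegral₃_swap_right {w : ℝ → ℝ → ℝ → ENNReal}
    (hw : Measurable fun p : ℝ × ℝ × ℝ => w p.1 p.2.1 p.2.2) :
    ∫⁻ x, ∫⁻ y, ∫⁻ z, w x z y ∂μ ∂μ ∂μ = ∫⁻ x, ∫⁻ y, ∫⁻ z, w x y z ∂μ ∂μ ∂μ := by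
  refine lintegral_congr fun x => ?_
  rw [lintegral_lintegral_swap]
  have h : Measurable fun q : ℝ × ℝ => w x q.2 q.1 :=
    hw.comp (measurable_const.prodMk (measurable_snd.prodMk measurable_fst))
  exact h.aemeasurable

theorem lintegral₃_eq_lintegral_prod {w : ℝ → ℝ → ℝ → ENNReal}
    (hw : Measurable fun p : ℝ × ℝ × ℝ => w p.1 p.2.1 p.2.2) :
    ∫⁻ p, w p.1 p.2.1 p.2.2 ∂(μ.prod (μ.prod μ)) = ∫⁻ x, ∫⁻ y, ∫⁻ z, w x y z ∂μ ∂μ ∂μ := by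
  rw [lintegral_prod _ hw.aemeasurable]
  refine lintegral_congr fun x => ?_
  rw [lintegral_prod]
  exact (hw.comp (measurable_const.prodMk measurable_id)).aemeasurable

/-- The integral of a symmetric function is six times its integral over the ordered region. -/
theorem lintegral₃_symmetric [NullSingletonClass μ] {f : ℝ → ℝ → ℝ → ENNReal}
    (hf : Measurable fun p : ℝ × ℝ × ℝ => f p.1 p.2.1 p.2.2)
    (h12 : ∀ x y z, f y x z = f x y z) (h23 : ∀ x y z, f x z y = f x y z) :
    ∫⁻ p, f p.1 p.2.1 p.2.2 ∂(μ.prod (μ.prod μ))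
      = 6 * ∫⁻ x, ∫⁻ y, ∫⁻ z, (if x < y ∧ y < z then f x y z else 0) ∂μ ∂μ ∂μ := by
  set w : ℝ → ℝ → ℝ → ENNReal := fun x y z => if x < y ∧ y < z then f x y z else 0 with hwdef
  have hw : Measurable fun p : ℝ × ℝ × ℝ => w p.1 p.2.1 p.2.2 :=
    Measurable.ite ((measurableSet_lt measurable_fst measurable_snd.fst).inter
      (measurableSet_lt measurable_snd.fst measurable_snd.snd)) hf measurable_const
  have m : ∀ g : ℝ × ℝ × ℝ → ℝ × ℝ × ℝ, Measurable g →
      Measurable fun p => w (g p).1 (g p).2.1 (g p).2.2 := fun g hg => hw.comp hg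
  have m2 := m (fun p => (p.1, p.2.2, p.2.1)) (by fun_prop)
  have m3 := m (fun p => (p.2.1, p.1, p.2.2)) (by fun_prop)
  have m4 := m (fun p => (p.2.1, p.2.2, p.1)) (by fun_prop)
  have m5 := m (fun p => (p.2.2, p.1, p.2.1)) (by fun_prop)
  have m6 := m (fun p => (p.2.2, p.2.1, p.1)) (by fun_prop)
  simp only at m2 m3 m4 m5 m6
  have e2 := lintegral₃_swap_right (μ := μ) hw
  have e3 := lintegral₃_swap_left (μ := μ) hw
  have e4 := (lintegral₃_swap_right (μ := μ) (w := fun x y z => w y x z) m3).trans e3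
  have e5 := (lintegral₃_swap_left (μ := μ) (w := fun x y z => w x z y) m2).trans e2
  have e6 :=
    (lintegral₃_swap_right (μ := μ) (w := fun x y z => w y z x) m4).trans e5
  -- For distinct coordinates exactly one of the six orderings holds; coincidences are null since μ
  -- has no atoms.
  have hsum : ∀ x y z, x ≠ y → x ≠ z → y ≠ z → f x y z
      = w x y z + (w x z y + (w y x z + (w y z x + (w z x y + w z y x)))) := by
    intro x y z hxy hxz hyz
    have a1 : f x z y = f x y z := h23 x y z
    have a2 : f y x z = f x y z := h12 x y z
    have a3 : f y z x = f x y z := (h23 y x z).trans a2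
    have a4 : f z x y = f x y z := (h12 x z y).trans a1
    have a5 : f z y x = f x y z := (h23 z x y).trans a4
    simp only [hwdef, a1, a2, a3, a4, a5]
    rcases lt_or_gt_of_ne hxy with h | h <;> rcases lt_or_gt_of_ne hxz with h' | h' <;>
      rcases lt_or_gt_of_ne hyz with h'' | h'' <;>
      first
      | (exfalso; linarith)
      | simp [h, h', h'', h.not_gt, h'.not_gt, h''.not_gt]
  rw [lintegral₃_eq_lintegral_prod hf]
  have hne : ∀ x : ℝ, ∀ᵐ y ∂μ, x ≠ y := fun x => by
    filter_upwards [compl_mem_ae_iff.2 (measure_singleton (μ := μ) x)] with y hy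
    exact fun h => hy h.symm
  have h1 : ∫⁻ x, ∫⁻ y, ∫⁻ z, f x y z ∂μ ∂μ ∂μ = ∫⁻ x, ∫⁻ y, ∫⁻ z,
      (w x y z + (w x z y + (w y x z + (w y z x + (w z x y + w z y x))))) ∂μ ∂μ ∂μ := by
    refine lintegral_congr fun x => lintegral_congr_ae ?_
    filter_upwards [hne x] with y hy
    refine lintegral_congr_ae ?_
    filter_upwards [hne x, hne y] with z hz hz'
    exact hsum x y z hy hz hz'
  rw [h1, ← lintegral₃_eq_lintegral_prod (by fun_prop), lintegral_add_left hw,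
    lintegral_add_left m2, lintegral_add_left m3, lintegral_add_left m4, lintegral_add_left m5,
    lintegral₃_eq_lintegral_prod hw,
    lintegral₃_eq_lintegral_prod (w := fun x y z => w x z y) m2,
    lintegral₃_eq_lintegral_prod (w := fun x y z => w y x z) m3,
    lintegral₃_eq_lintegral_prod (w := fun x y z => w y z x) m4,
    lintegral₃_eq_lintegral_prod (w := fun x y z => w z x y) m5,
    lintegral₃_eq_lintegral_prod (w := fun x y z => w z y x) m6, e2, e3, e4, e5, e6]
  ring

end Symmetrization

/-! ### Reduction of the cube integral to one variable. -/

theorem lintegral_middle {x z : ℝ} (hx : 0 < x) (hxz : x < z) :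
    ∫⁻ y in Ioo x z, ENNReal.ofReal (1 / ((x + y) * (y + z) * (z + x)))
      = ENNReal.ofReal ((2 * Real.log (x + z) - Real.log (2 * x) - Real.log (2 * z))
          / ((z - x) * (z + x))) := by
  have hz : 0 < z := hx.trans hxz
  have hzx : 0 < z - x := sub_pos.2 hxz
  have hc : ContinuousOn (fun y => 1 / ((x + y) * (y + z) * (z + x))) (Icc x z) := by
    refine continuousOn_const.div (by fun_prop) fun y hy => ?_
    have : 0 < y := hx.trans_le hy.1
    positivity
  have hi : IntegrableOn (fun y => 1 / ((x + y) * (y + z) * (z + x))) (Ioo x z) :=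
    hc.integrableOn_Icc.mono_set Ioo_subset_Icc_self
  rw [← ofReal_integral_eq_lintegral_ofReal hi (ae_restrict_of_forall_mem measurableSet_Ioo
    fun y hy => by
      have : 0 < y := hx.trans hy.1
      positivity), ← integral_Ioc_eq_integral_Ioo, ← intervalIntegral.integral_of_le hxz.le]
  congr 1
  have hd : ∀ y ∈ uIcc x z, HasDerivAt
      (fun y => (Real.log (x + y) - Real.log (y + z)) / ((z - x) * (z + x)))
      (1 / ((x + y) * (y + z) * (z + x))) y := by
    intro y hy
    rw [uIcc_of_le hxz.le] at hy
    have hy0 : 0 < y := hx.trans_le hy.1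
    have h1 : HasDerivAt (fun y => Real.log (x + y)) (1 / (x + y)) y :=
      ((hasDerivAt_id y).const_add x).log (by simp; positivity)
    have h2 : HasDerivAt (fun y => Real.log (y + z)) (1 / (y + z)) y :=
      ((hasDerivAt_id y).add_const z).log (by simp; positivity)
    refine ((h1.sub h2).div_const _).congr_deriv ?_
    have : x + y ≠ 0 := by positivity
    have : y + z ≠ 0 := by positivity
    have : z + x ≠ 0 := by positivity
    field_simp
    ring
  rw [intervalIntegral.integral_eq_sub_of_hasDerivAt hd (by
    rw [intervalIntegrable_iff_integrableOn_Ioo_of_le hxz.le]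
    exact hi), ← sub_div, two_mul x, two_mul z, add_comm z x]
  congr 1
  ring

theorem lintegral_one_div {c : ℝ} (hc : 0 ≤ c) :
    ∫⁻ x in Icc 1 c, ENNReal.ofReal (1 / x) = ENNReal.ofReal (Real.log c) := by
  rcases lt_or_ge c 1 with h | h
  · rw [Icc_eq_empty (not_le.2 h)]
    -- For c < 1 the domain is empty and `ENNReal.ofReal` truncates the negative logarithm; this
    -- later produces the `max` with 0.
    simp [ENNReal.ofReal_of_nonpos (Real.log_nonpos hc h.le)]
  · have hi : IntegrableOn (fun x : ℝ => 1 / x) (Icc 1 c) :=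
      (continuousOn_const.div continuousOn_id fun y hy =>
        (zero_lt_one.trans_le hy.1).ne').integrableOn_Icc
    rw [← ofReal_integral_eq_lintegral_ofReal hi (ae_restrict_of_forall_mem measurableSet_Icc
      fun y hy => one_div_nonneg.2 (zero_le_one.trans hy.1)), integral_Icc_eq_integral_Ioc,
      ← intervalIntegral.integral_of_le h, integral_one_div_of_pos one_pos (one_pos.trans_le h),
      div_one]

/-- The substitution `z = x (1 + v) / (1 - v)`. -/
theorem lintegral_outer {x N : ℝ} (hx : 0 < x) :
    ∫⁻ z in Ioi x, (if z ≤ N then ENNReal.ofReal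
        ((2 * Real.log (x + z) - Real.log (2 * x) - Real.log (2 * z)) / ((z - x) * (z + x))) else 0)
      = ∫⁻ v in Ioo (0 : ℝ) 1, (if x * (1 + v) / (1 - v) ≤ N then
          ENNReal.ofReal (1 / x) * ENNReal.ofReal (-Real.log (1 - v ^ 2) / (2 * v)) else 0) := by
  have him : (fun v => x * (1 + v) / (1 - v)) '' Ioo 0 1 = Ioi x := by
    ext z
    constructor
    · rintro ⟨v, ⟨h0, h1⟩, rfl⟩
      rw [mem_Ioi, lt_div_iff₀ (by linarith)]
      nlinarith
    · intro hz
      have hz : x < z := hz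
      have hz0 : 0 < z := hx.trans hz
      refine ⟨(z - x) / (z + x), ⟨div_pos (by linarith) (by linarith),
        (div_lt_one (by linarith)).2 (by linarith)⟩, ?_⟩
      have h1 : z + x ≠ 0 := by positivity
      have h2 : 1 + (z - x) / (z + x) = 2 * z / (z + x) := by field_simp; ring
      have h3 : 1 - (z - x) / (z + x) = 2 * x / (z + x) := by field_simp; ring
      simp only
      rw [h2, h3]
      field_simp
  have hinj : InjOn (fun v => x * (1 + v) / (1 - v)) (Ioo 0 1) := by
    intro a ha b hb h
    have h1 : 1 - a ≠ 0 := (sub_pos.2 ha.2).ne'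
    have h2 : 1 - b ≠ 0 := (sub_pos.2 hb.2).ne'
    simp only at h
    rw [div_eq_div_iff h1 h2, mul_assoc, mul_assoc] at h
    have := mul_left_cancel₀ hx.ne' h
    linarith
  have hd : ∀ v ∈ Ioo (0 : ℝ) 1, HasDerivWithinAt (fun v => x * (1 + v) / (1 - v))
      (2 * x / (1 - v) ^ 2) (Ioo 0 1) v := by
    intro v hv
    have h1 : 1 - v ≠ 0 := (sub_pos.2 hv.2).ne'
    refine (((((hasDerivAt_id v).const_add 1).const_mul x).div ((hasDerivAt_id v).const_sub 1)
      h1).congr_deriv ?_).hasDerivWithinAt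
    simp only [id]
    ring
  rw [← him, lintegral_image_eq_lintegral_abs_deriv_mul measurableSet_Ioo hd hinj]
  refine setLIntegral_congr_fun measurableSet_Ioo fun v hv => ?_
  have hv0 := hv.1
  have h1 : 0 < 1 - v := sub_pos.2 hv.2
  have h2 : 0 < 1 + v := by linarith
  split_ifs
  · rw [abs_of_pos (by positivity), ← ENNReal.ofReal_mul (by positivity),
      ← ENNReal.ofReal_mul (by positivity)]
    congr 1
    -- By homogeneity x cancels from the logarithms, and the density factors as 1/x times a function
    -- of v.
    have e1 : x + x * (1 + v) / (1 - v) = 2 * x / (1 - v) := by field_simp; ring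
    have e2 : 2 * (x * (1 + v) / (1 - v)) = 2 * x * (1 + v) / (1 - v) := by ring
    have e3 : (x * (1 + v) / (1 - v) - x) * (x * (1 + v) / (1 - v) + x)
        = 4 * x ^ 2 * v / (1 - v) ^ 2 := by field_simp; ring
    have e4 : 1 - v ^ 2 = (1 - v) * (1 + v) := by ring
    rw [e1, e2, e3, e4, Real.log_mul h1.ne' h2.ne', Real.log_div (by positivity) h1.ne',
      Real.log_div (by positivity) h1.ne', Real.log_mul (by positivity) h2.ne']
    field_simp
    ring
  · rw [mul_zero]

theorem lintegral_ordered {N : ℝ} (hN : 0 ≤ N) :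
    ∫⁻ x in Icc 1 N, ∫⁻ y in Icc 1 N, ∫⁻ z in Icc 1 N, (if x < y ∧ y < z then
        ENNReal.ofReal (1 / ((x + y) * (y + z) * (z + x))) else 0)
      = ∫⁻ v in Ioo (0 : ℝ) 1, ENNReal.ofReal (-Real.log (1 - v ^ 2) / (2 * v))
          * ENNReal.ofReal (Real.log (N * (1 - v) / (1 + v))) := by
  have hm : Measurable fun p : ℝ × ℝ × ℝ => if p.1 < p.2.1 ∧ p.2.1 < p.2.2 then
      ENNReal.ofReal (1 / ((p.1 + p.2.1) * (p.2.1 + p.2.2) * (p.2.2 + p.1))) else 0 :=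
    Measurable.ite ((measurableSet_lt measurable_fst measurable_snd.fst).inter
      (measurableSet_lt measurable_snd.fst measurable_snd.snd)) (by fun_prop) measurable_const
  -- The middle variable must be integrated first.
  rw [← lintegral₃_swap_right hm]
  have h1 : ∀ x ∈ Icc 1 N, ∫⁻ z in Icc 1 N, ∫⁻ y in Icc 1 N, (if x < y ∧ y < z then
        ENNReal.ofReal (1 / ((x + y) * (y + z) * (z + x))) else 0)
      = ∫⁻ v in Ioo (0 : ℝ) 1, (if x * (1 + v) / (1 - v) ≤ N then
          ENNReal.ofReal (1 / x) * ENNReal.ofReal (-Real.log (1 - v ^ 2) / (2 * v)) else 0) := by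
    intro x hx
    have hx0 : 0 < x := zero_lt_one.trans_le hx.1
    rw [← lintegral_outer hx0, ← lintegral_indicator measurableSet_Icc,
      ← lintegral_indicator measurableSet_Ioi]
    refine lintegral_congr fun z => ?_
    have h2 : (fun y => if x < y ∧ y < z then
        ENNReal.ofReal (1 / ((x + y) * (y + z) * (z + x))) else 0)
        = (Ioo x z).indicator fun y => ENNReal.ofReal (1 / ((x + y) * (y + z) * (z + x))) := by
      funext y
      simp [indicator, mem_Ioo]
    simp only [indicator, h2, mem_Icc, mem_Ioi]
    rw [lintegral_indicator measurableSet_Ioo, Measure.restrict_restrict measurableSet_Ioo]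
    by_cases hxz : x < z
    · by_cases hzN : z ≤ N
      · rw [if_pos ⟨hx.1.trans hxz.le, hzN⟩, if_pos hxz, if_pos hzN,
          inter_eq_left.2 (show Ioo x z ⊆ Icc 1 N from
            fun y hy => ⟨hx.1.trans hy.1.le, hy.2.le.trans hzN⟩),
          lintegral_middle hx0 hxz]
      · rw [if_neg (fun h => hzN h.2), if_pos hxz, if_neg hzN]
    · rw [if_neg hxz, Ioo_eq_empty hxz]
      simp
  rw [setLIntegral_congr_fun measurableSet_Icc h1, lintegral_lintegral_swap]
  · refine setLIntegral_congr_fun measurableSet_Ioo fun v hv => ?_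
    have hv0 := hv.1
    have hv1 : 0 < 1 - v := sub_pos.2 hv.2
    have hv2 : 0 < 1 + v := by linarith
    rw [← lintegral_one_div (by positivity),
      mul_comm (ENNReal.ofReal (-Real.log (1 - v ^ 2) / (2 * v))), ← lintegral_mul_const _ (by fun_prop),
      ← lintegral_indicator measurableSet_Icc, ← lintegral_indicator measurableSet_Icc]
    refine lintegral_congr fun x => ?_
    -- The cutoff z ≤ N becomes an upper bound for x, so dx/x integrates to a logarithm.
    have h3 : x * (1 + v) / (1 - v) ≤ N ↔ x ≤ N * (1 - v) / (1 + v) := by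
      rw [div_le_iff₀ hv1, le_div_iff₀ hv2]
    simp only [indicator, mem_Icc, h3]
    by_cases hx1 : 1 ≤ x
    · by_cases hx2 : x ≤ N * (1 - v) / (1 + v)
      · have hx3 : x ≤ N := by
          rw [← h3, div_le_iff₀ hv1] at hx2
          by_contra hc
          nlinarith
        simp [hx1, hx2, hx3]
      · simp [hx2]
    · simp [hx1]
  · refine Measurable.aemeasurable ?_
    refine Measurable.ite (measurableSet_le (by fun_prop) measurable_const) (by fun_prop)
      measurable_const

/-- The integral over the cube reduces to a single integral over `(0, 1)`. -/
theorem integral_cube_eq {N : ℝ} (hN : 0 < N) :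
    ∫ p : ℝ × ℝ × ℝ in Icc (1 : ℝ) N ×ˢ (Icc (1 : ℝ) N ×ˢ Icc (1 : ℝ) N),
        1 / ((p.1 + p.2.1) * (p.2.1 + p.2.2) * (p.2.2 + p.1))
      = ∫ v in Ioo (0 : ℝ) 1, -3 * Real.log (1 - v ^ 2) / v
          * max (Real.log N - (Real.log (1 + v) - Real.log (1 - v))) 0 := by
  have hnn : ∀ p ∈ Icc (1 : ℝ) N ×ˢ (Icc (1 : ℝ) N ×ˢ Icc (1 : ℝ) N),
      0 ≤ 1 / ((p.1 + p.2.1) * (p.2.1 + p.2.2) * (p.2.2 + p.1)) := by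
    rintro ⟨x, y, z⟩ ⟨hx, hy, hz⟩
    have hx : 1 ≤ x := hx.1
    have hy : 1 ≤ y := hy.1
    have hz : 1 ≤ z := hz.1
    simp only
    positivity
  have hlog : ∀ v ∈ Ioo (0 : ℝ) 1, 0 ≤ -Real.log (1 - v ^ 2) := fun v hv => by
    have := Real.log_nonpos (x := 1 - v ^ 2) (by nlinarith [hv.1, hv.2]) (by nlinarith [hv.1])
    linarith
  rw [integral_eq_lintegral_of_nonneg_ae
    (ae_restrict_of_forall_mem (measurableSet_Icc.prod (measurableSet_Icc.prod measurableSet_Icc))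
      hnn) (Measurable.aestronglyMeasurable (by fun_prop)),
    integral_eq_lintegral_of_nonneg_ae (ae_restrict_of_forall_mem measurableSet_Ioo fun v hv => by
      have h1 := hlog v hv
      have h2 := hv.1
      have h3 : -3 * Real.log (1 - v ^ 2) / v = 3 * (-Real.log (1 - v ^ 2)) / v := by ring
      rw [h3]
      positivity) (Measurable.aestronglyMeasurable (by fun_prop)),
    Measure.volume_eq_prod, Measure.volume_eq_prod, ← Measure.prod_restrict,
    ← Measure.prod_restrict,
    lintegral₃_symmetric (f := fun x y z => ENNReal.ofReal (1 / ((x + y) * (y + z) * (z + x))))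
      (by fun_prop) (fun x y z => by congr 2; ring) (fun x y z => by congr 2; ring),
    lintegral_ordered hN.le, ← lintegral_const_mul _ (by fun_prop)]
  congr 1
  refine setLIntegral_congr_fun measurableSet_Ioo fun v hv => ?_
  have hv0 := hv.1
  have hv1 : 0 < 1 - v := sub_pos.2 hv.2
  have hv2 : 0 < 1 + v := by linarith
  have h1 := hlog v hv
  rw [Real.log_div (by positivity) hv2.ne', Real.log_mul hN.ne' hv1.ne',
    show (6 : ENNReal) = ENNReal.ofReal 6 by simp, ← mul_assoc, ← ENNReal.ofReal_mul (by norm_num)]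
  have h4 : Real.log N + Real.log (1 - v) - Real.log (1 + v)
      = Real.log N - (Real.log (1 + v) - Real.log (1 - v)) := by ring
  rw [h4]
  rcases le_total (Real.log N - (Real.log (1 + v) - Real.log (1 - v))) 0 with h | h
  · rw [max_eq_right h, ENNReal.ofReal_of_nonpos h]
    simp
  · rw [max_eq_left h, ← ENNReal.ofReal_mul (by positivity)]
    congr 1
    ring

/-! ### Evaluation of the constants and the limit. -/

theorem log_one_sub_sq_eq {t : ℝ} (ht : t ∈ Ioo (0 : ℝ) 1) :
    Real.log (1 - t ^ 2) = Real.log (1 + t) + Real.log (1 - t) := by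
  have h1 : 1 - t ≠ 0 := (sub_pos.2 ht.2).ne'
  have h2 : 1 + t ≠ 0 := by have := ht.1; positivity
  rw [← Real.log_mul h2 h1]
  congr 1
  ring

/-- With A = log(1+t) and B = log(1-t): A(A-B) = (A+B)²/4 + 3(A-B)²/4 - B². -/
theorem hasUnitIntegral_harmonicRiemannLimit :
    HasUnitIntegral (fun t => (Real.log (1 + t) - Real.log t)
      * (Real.log (1 + t) - Real.log (1 - t)) / t) (21 / 8 * zetaThree) := by
  refine ((((hasUnitIntegral_log_one_sub_sq_sq.const_mul (1 / 4)).add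
    (hasUnitIntegral_log_div_sq.const_mul (3 / 4))).add
    (hasUnitIntegral_log_one_sub_sq.const_mul (-1))).add
    hasUnitIntegral_log_mul_log_div).congr (fun t ht => ?_) (by ring)
  rw [log_one_sub_sq_eq ht]
  ring

/-- With the analogous A and B: 3(A²-B²) = (3/2)(A+B)² + (3/2)(A-B)² - 6B². -/
theorem hasUnitIntegral_cubeConstant :
    HasUnitIntegral (fun v => 3 * Real.log (1 - v ^ 2) / v
      * (Real.log (1 + v) - Real.log (1 - v))) (-21 / 4 * zetaThree) := by
  refine (((hasUnitIntegral_log_one_sub_sq_sq.const_mul (3 / 2)).add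
    (hasUnitIntegral_log_div_sq.const_mul (3 / 2))).add
    (hasUnitIntegral_log_one_sub_sq.const_mul (-6))).congr (fun t ht => ?_) (by ring)
  rw [log_one_sub_sq_eq ht]
  ring

/-- Writing max(ℓ - L, 0) = ℓ - min(L, ℓ) with ℓ = log(k+1) splits off the divergent part exactly;
the rest is dominated by its limit, where the minimum becomes L. -/
theorem tendsto_integral_cube :
    Tendsto (fun k : ℕ => (∫ p : ℝ × ℝ × ℝ in
        Icc (1 : ℝ) ((k : ℝ) + 1) ×ˢ (Icc (1 : ℝ) ((k : ℝ) + 1) ×ˢ Icc (1 : ℝ) ((k : ℝ) + 1)),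
        1 / ((p.1 + p.2.1) * (p.2.1 + p.2.2) * (p.2.2 + p.1)))
        - 3 / 2 * zetaTwo * Real.log ((k : ℝ) + 1)) atTop (𝓝 (-21 / 4 * zetaThree)) := by
  set L : ℝ → ℝ := fun v => Real.log (1 + v) - Real.log (1 - v) with hL
  have hL0 : ∀ v ∈ Ioo (0 : ℝ) 1, 0 ≤ L v := fun v hv => by
    have := Real.log_le_log (sub_pos.2 hv.2) (by linarith [hv.1] : 1 - v ≤ 1 + v)
    simp only [hL]
    linarith
  set g : ℕ → ℝ → ℝ := fun k v => 3 * Real.log (1 - v ^ 2) / v * min (L v) (Real.log ((k : ℝ) + 1))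
    with hg
  have hlogk : ∀ k : ℕ, 0 ≤ Real.log ((k : ℝ) + 1) := fun k =>
    Real.log_nonneg (by linarith [(k.cast_nonneg : (0 : ℝ) ≤ k)])
  have hmeas : ∀ k, Measurable (g k) := fun k => by
    simp only [hg, hL]
    fun_prop
  have hb : ∀ k, ∀ v ∈ Ioo (0 : ℝ) 1, ‖g k v‖ ≤ ‖3 * Real.log (1 - v ^ 2) / v * L v‖ := by
    intro k v hv
    simp only [hg, norm_mul]
    refine mul_le_mul_of_nonneg_left ?_ (norm_nonneg _)
    rw [Real.norm_of_nonneg (le_min (hL0 v hv) (hlogk k)), Real.norm_of_nonneg (hL0 v hv)]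
    exact min_le_left _ _
  have hint : ∀ k, IntegrableOn (g k) (Ioo 0 1) := fun k =>
    Integrable.mono hasUnitIntegral_cubeConstant.1 (hmeas k).aestronglyMeasurable
      (ae_restrict_of_forall_mem measurableSet_Ioo (hb k))
  have hlim : Tendsto (fun k => ∫ v in Ioo (0 : ℝ) 1, g k v) atTop (𝓝 (-21 / 4 * zetaThree)) := by
    rw [← hasUnitIntegral_cubeConstant.2]
    refine tendsto_integral_of_dominated_convergence _
      (fun k => (hmeas k).aestronglyMeasurable) hasUnitIntegral_cubeConstant.1.norm
      (fun k => ae_restrict_of_forall_mem measurableSet_Ioo (hb k))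
      (ae_restrict_of_forall_mem measurableSet_Ioo fun v _ => ?_)
    refine tendsto_const_nhds.congr' ?_
    have hk : Tendsto (fun k : ℕ => Real.log ((k : ℝ) + 1)) atTop atTop :=
      Real.tendsto_log_atTop.comp (tendsto_atTop_add_const_right _ _ tendsto_natCast_atTop_atTop)
    filter_upwards [hk.eventually_ge_atTop (L v)] with k hk
    simp only [hg, min_eq_left hk]
    rfl
  refine hlim.congr fun k => ?_
  rw [integral_cube_eq (by positivity)]
  have h0 := hasUnitIntegral_neg_log_one_sub_sq.const_mul (3 * Real.log ((k : ℝ) + 1))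
  have h1 : ∫ v in Ioo (0 : ℝ) 1, -3 * Real.log (1 - v ^ 2) / v
        * max (Real.log ((k : ℝ) + 1) - (Real.log (1 + v) - Real.log (1 - v))) 0
      = ∫ v in Ioo (0 : ℝ) 1, (g k v
        + 3 * Real.log ((k : ℝ) + 1) * (-Real.log (1 - v ^ 2) / v)) := by
    refine setIntegral_congr_fun measurableSet_Ioo fun v _ => ?_
    have h2 : max (Real.log ((k : ℝ) + 1) - L v) 0
        = Real.log ((k : ℝ) + 1) - min (L v) (Real.log ((k : ℝ) + 1)) := by
      rw [← max_sub_sub_left, sub_self]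
    change _ * max (Real.log ((k : ℝ) + 1) - L v) 0 = _
    simp only [hg]
    rw [h2]
    ring
  rw [h1, integral_add (hint k) h0.1, h0.2]
  ring

theorem tendsto_symmetricDifference : Tendsto symmetricDifference atTop
    (𝓝 (3 / 2 * zetaTwo * Real.eulerMascheroniConstant + 1 / 8 * zetaThree)) := by
  have h1 := tendsto_harmonicRiemannSum
  rw [hasUnitIntegral_harmonicRiemannLimit.2] at h1
  have h2 := (((h1.neg.add (tendsto_harmonicSum_mul_sum.const_mul (3 / 2))).sub
    (tendsto_tornheimSum.const_mul (5 / 4))).sub tendsto_integral_cube).sub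
    (Real.tendsto_log_nat_add_one_sub_log.const_mul (3 / 2 * zetaTwo))
  have h3 : -(21 / 8 * zetaThree) + 3 / 2 * (zetaTwo * Real.eulerMascheroniConstant)
      - 5 / 4 * (2 * zetaThree) - -21 / 4 * zetaThree - 3 / 2 * zetaTwo * 0
      = 3 / 2 * zetaTwo * Real.eulerMascheroniConstant + 1 / 8 * zetaThree := by ring
  rw [h3] at h2
  refine h2.congr fun k => ?_
  rw [symmetricDifference, symmetric_sum_eq]
  ring

theorem theorem1p3 :
    Filter.Tendsto (fun k : ℕ => ((symmetricDifference k : ℝ) : ℂ)) Filter.atTop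
      (nhds (3 / 2 * riemannZeta 2 * (Real.eulerMascheroniConstant : ℂ)
        + 1 / 8 * riemannZeta 3)) := by
  rw [riemannZeta_two_eq, riemannZeta_three_eq]
  have h := (Complex.continuous_ofReal.tendsto _).comp tendsto_symmetricDifference
  push_cast at h
  exact h
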